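/- **Setting.** Let $(v_1,v_2)$ be a positively oriented basis of $\mathbb R^2$, $\mathcal K_1=\mathbb Z v_1+\mathbb Z v_2$, $\mathcal K_2=\mathcal K_1+\tfrac12 v_1$, $\mathcal K_3=\mathcal K_1+\tfrac12v_2$. The vertices of the Kagome graph are $\mathcal K=\mathcal K_1\cup\mathcal K_2\cup\mathcal K_3$; its edges join nearest neighbours and are oriented anticlockwise around the hexagons and clockwise around the triangles. Their centers form the set $$\mathcal R=\{z\pm\tfrac14 v_j: j\in\{1,2\}, z\in\mathcal K_1\}\cup\{z+\tfrac12v_1\pm\tfrac14(v_1-v_2): z\in\mathcal K_1\}.$$ Each $z\in\mathcal K$ has two incoming edges, with centers $z\pm a_z$, and two outgoing edges, with centers $z\pm b_z$, where $(a_z,b_z)=(\tfrac14v_1,-\tfrac14v_2)$ for $z\in\mathcal K_1$, $(\tfrac14(v_1-v_2),-\tfrac14v_1)$ for $z\in\mathcal K_2$ and $(\tfrac14v_2,\tfrac14(v_1-v_2))$ for $z\in\mathcal K_3$; the current coming in on $z\pm a_z$ turns left into $z\pm b_z$ (same sign) and right into $z\mp b_z$. Each point of $\mathcal R$ is incoming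 to exactly one $z\in\mathcal K$ and outgoing from exactly one. Given an arbitrary family $S_z\in U(2)$, $z\in\mathcal K$, the Chalker–Coddington model is the unitary operator $U$ on $\ell^2(\mathcal R;\mathbb C)$ which maps, for every $z$, the span of the two incoming basis vectors $|z+a_z\rangle,|z-a_z\rangle$ onto the span of the two outgoing basis vectors $|z+b_z\rangle,|z-b_z\rangle$ by the matrix $S_z$ (with respect to these bases in this order). Let $|r_z|=|\langle z+b_z,U(z+a_z)\rangle|=|\langle z-b_z,U(z-a_z)\rangle|$ be the modulus of the amplitude for scattering to the left at $z$ (and $|t_z|$ the one for scattering to the right, so $|r_z|^2+|t_z|^2=1$). The Ruby graph $G$ has vertex set $\mathcal R$ and, for every $z\in\mathcal K$, the four directed edges from the incoming to the outgoing vertices at $z$, drawn as straight segments. Its faces are rectangles (parallelograms) centered at the points of $\mathcal K$, hexagons and triangles; the vertices of the dual graph $G^*$ are the centers of the faces, and its links are the segments joining the centers of two adjacent faces; each link bisects exactly one edge of $G$. An admissible path is an injective bi-infinite path $\gamma:\mathbb Z\to G^*$, consecutive points being joined by links, for which there is a partition of $\mathcal R$ into infinite sets $\mathcal R_+$ and $\mathcal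 R_-$ inducing connected subgraphs of $G$, such that the edges bisected by the links of $\gamma$ are exactly the edges between $\mathcal R_+$ and $\mathcal R_-$ and such that $\mathcal R_+$ lies to the left of $\gamma$: of the two endpoints of each bisected edge, the one to the left of the link is in $\mathcal R_+$. Let $P_\gamma$ be the multiplication operator by the indicator function of $\mathcal R_+$ (a half-space projection) and $\Phi_\gamma=U^*P_\gamma U-P_\gamma$ its flux operator. If $1$ is an isolated eigenvalue of finite multiplicity of $\Phi_\gamma^2$, then the index $$\operatorname{ind}(\Phi_\gamma)=\dim\ker(\Phi_\gamma-1)-\dim\ker(\Phi_\gamma+1)\in\mathbb Z$$ is defined. **Statement.** Let $U$ be a Chalker–Coddington model on the Ruby graph such that, for some constants $c_1,c_2$, $0<c_1<|r_z|<c_2<1$ for all $z\in\mathcal K$. Then there is an admissible path $\gamma$ such that $\operatorname{ind}(\Phi_\gamma)$ is defined and $\operatorname{ind}(\Phi_\gamma)\neq0$. -/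

import Mathlib

/-!
# Chalker-Coddington models on the Ruby graph

All points of the plane are given by their coordinates with respect to a positively oriented
basis `(v₁, v₂)` of `ℝ²`, in units of one twelfth: the pair `(a, b) : ℤ × ℤ` stands for the point
`(a / 12) v₁ + (b / 12) v₂`. In particular `v₁ = (12, 0)`, `v₂ = (0, 12)`, `v₁ / 4 = (3, 0)`, and
the centres of the triangles, `z ± (v₁ + v₂) / 6`, are `z ± (2, 2)`. Every notion below is
invariant under orientation preserving linear maps, so it does not depend on the basis.
-/

namespace RubyCC

/-! ## Geometry of the Kagome and Ruby graphs -/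

/-- The lattice `ℤ v₁ + ℤ v₂`. -/
def kagome₁ : Set (ℤ × ℤ) := {z | ∃ n₁ n₂ : ℤ, z = (12 * n₁, 12 * n₂)}

/-- The lattice shifted by `v₁ / 2`. -/
def kagome₂ : Set (ℤ × ℤ) := {z | ∃ p ∈ kagome₁, z = p + (6, 0)}

/-- The lattice shifted by `v₂ / 2`. -/
def kagome₃ : Set (ℤ × ℤ) := {z | ∃ p ∈ kagome₁, z = p + (0, 6)}

/-- The vertices of the Kagome graph (the scattering points). -/
def kagomeSet : Set (ℤ × ℤ) := kagome₁ ∪ kagome₂ ∪ kagome₃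

/-- The centres of the edges of the Kagome graph: the points `z ± v_j / 4` and
`z + v₁ / 2 ± (v₁ - v₂) / 4`, with `z` in the lattice. -/
def rubySet : Set (ℤ × ℤ) :=
  {w | ∃ z ∈ kagome₁, w = z + (3, 0) ∨ w = z - (3, 0) ∨ w = z + (0, 3) ∨ w = z - (0, 3) ∨
    w = z + (6, 0) + (3, -3) ∨ w = z + (6, 0) - (3, -3)}

/-- The centres of the hexagons. -/
def hexagonCenters : Set (ℤ × ℤ) := {f | ∃ z ∈ kagome₁, f = z + (6, 6)}

/-- The centres of the triangles. -/
def triangleCenters : Set (ℤ × ℤ) := {f | ∃ z ∈ kagome₁, f = z + (2, 2) ∨ f = z - (2, 2)}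

/-- The vertices of the dual of the Ruby graph: the centres of its faces, which are rectangles
(centred at the Kagome vertices), hexagons and triangles. -/
def dualVertices : Set (ℤ × ℤ) := kagomeSet ∪ hexagonCenters ∪ triangleCenters

/-- The type of Kagome vertices. -/
abbrev Kagome : Type := {z : ℤ × ℤ // z ∈ kagomeSet}

/-- The type of vertices of the Ruby graph. -/
abbrev Ruby : Type := {w : ℤ × ℤ // w ∈ rubySet}

/-- `sgn 0 = 1`, `sgn 1 = -1`. -/
def sgn : Fin 2 → ℤ := ![1, -1]

open Classical in
/-- The two Kagome edges incoming to `z` have centres `z ± 3 • inDir z`: the directions are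
`v₁`, `v₁ - v₂`, `v₂` on the three sublattices. -/
noncomputable def inDir (z : ℤ × ℤ) : ℤ × ℤ :=
  if z ∈ kagome₁ then (1, 0) else if z ∈ kagome₂ then (1, -1) else (0, 1)

open Classical in
/-- The two Kagome edges outgoing from `z` have centres `z ± 3 • outDir z`. The sign is chosen
such that the current on the edge with centre `z + 3 • inDir z`, which flows in the direction
`-inDir z`, turns left into the edge with centre `z + 3 • outDir z`. -/
noncomputable def outDir (z : ℤ × ℤ) : ℤ × ℤ :=
  if z ∈ kagome₁ then (0, -1) else if z ∈ kagome₂ then (-1, 0) else (1, -1)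

lemma mem_kagome₁ {z : ℤ × ℤ} : z ∈ kagome₁ ↔ z.1 % 12 = 0 ∧ z.2 % 12 = 0 := by
  obtain ⟨x, y⟩ := z
  simp only [kagome₁, Set.mem_ofPred_eq, Prod.mk.injEq]
  constructor
  · rintro ⟨n, m, rfl, rfl⟩; omega
  · rintro ⟨h1, h2⟩; exact ⟨x / 12, y / 12, by omega, by omega⟩

lemma mem_kagome₂ {z : ℤ × ℤ} : z ∈ kagome₂ ↔ z.1 % 12 = 6 ∧ z.2 % 12 = 0 := by
  obtain ⟨x, y⟩ := z
  simp only [kagome₂, Set.mem_ofPred_eq]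
  constructor
  · rintro ⟨⟨a, b⟩, h, h'⟩
    rw [mem_kagome₁] at h
    simp only [Prod.mk_add_mk, Prod.mk.injEq] at h h'
    omega
  · rintro ⟨h1, h2⟩
    refine ⟨(x - 6, y), mem_kagome₁.2 ?_, ?_⟩
    · simp only at h1 h2 ⊢; omega
    · simp

lemma mem_kagome₃ {z : ℤ × ℤ} : z ∈ kagome₃ ↔ z.1 % 12 = 0 ∧ z.2 % 12 = 6 := by
  obtain ⟨x, y⟩ := z
  simp only [kagome₃, Set.mem_ofPred_eq]
  constructor
  · rintro ⟨⟨a, b⟩, h, h'⟩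
    rw [mem_kagome₁] at h
    simp only [Prod.mk_add_mk, Prod.mk.injEq] at h h'
    omega
  · rintro ⟨h1, h2⟩
    refine ⟨(x, y - 6), mem_kagome₁.2 ?_, ?_⟩
    · simp only at h1 h2 ⊢; omega
    · simp

lemma mem_rubySet {w : ℤ × ℤ} : w ∈ rubySet ↔
    (w.1 % 12 = 3 ∧ w.2 % 12 = 0) ∨ (w.1 % 12 = 9 ∧ w.2 % 12 = 0) ∨
    (w.1 % 12 = 0 ∧ w.2 % 12 = 3) ∨ (w.1 % 12 = 0 ∧ w.2 % 12 = 9) ∨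
    (w.1 % 12 = 9 ∧ w.2 % 12 = 9) ∨ (w.1 % 12 = 3 ∧ w.2 % 12 = 3) := by
  obtain ⟨x, y⟩ := w
  simp only [rubySet, Set.mem_ofPred_eq]
  constructor
  · rintro ⟨⟨a, b⟩, h, h'⟩
    rw [mem_kagome₁] at h
    simp only [Prod.mk_add_mk, Prod.mk_sub_mk, Prod.mk.injEq] at h h'
    omega
  · rintro (h | h | h | h | h | h)
    · refine ⟨(x - 3, y), mem_kagome₁.2 (by simp only at h ⊢; omega), ?_⟩
      simp
    · refine ⟨(x + 3, y), mem_kagome₁.2 (by simp only at h ⊢; omega), ?_⟩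
      simp
    · refine ⟨(x, y - 3), mem_kagome₁.2 (by simp only at h ⊢; omega), ?_⟩
      simp
    · refine ⟨(x, y + 3), mem_kagome₁.2 (by simp only at h ⊢; omega), ?_⟩
      simp
    · refine ⟨(x - 9, y + 3), mem_kagome₁.2 (by simp only at h ⊢; omega), ?_⟩
      simp only [Prod.mk_add_mk, Prod.mk_sub_mk, Prod.mk.injEq]; omega
    · refine ⟨(x - 3, y - 3), mem_kagome₁.2 (by simp only at h ⊢; omega), ?_⟩
      simp only [Prod.mk_add_mk, Prod.mk_sub_mk, Prod.mk.injEq]; omega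

/-- The three types of Kagome vertices, with the directions of the adjacent edges. -/
lemma kagome_cases (z : Kagome) :
    (z.1.1 % 12 = 0 ∧ z.1.2 % 12 = 0 ∧ inDir z.1 = (1, 0) ∧ outDir z.1 = (0, -1)) ∨
    (z.1.1 % 12 = 6 ∧ z.1.2 % 12 = 0 ∧ inDir z.1 = (1, -1) ∧ outDir z.1 = (-1, 0)) ∨
    (z.1.1 % 12 = 0 ∧ z.1.2 % 12 = 6 ∧ inDir z.1 = (0, 1) ∧ outDir z.1 = (1, -1)) := by
  obtain ⟨z, h⟩ := z
  rcases h with (h | h) | h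
  · left
    have h' := mem_kagome₁.1 h
    simp [inDir, outDir, h, h']
  · right; left
    have h' := mem_kagome₂.1 h
    have h1 : z ∉ kagome₁ := fun h1 => by have := mem_kagome₁.1 h1; omega
    simp [inDir, outDir, h, h', h1]
  · right; right
    have h' := mem_kagome₃.1 h
    have h1 : z ∉ kagome₁ := fun h1 => by have := mem_kagome₁.1 h1; omega
    have h2 : z ∉ kagome₂ := fun h1 => by have := mem_kagome₂.1 h1; omega
    simp [inDir, outDir, h', h1, h2]

lemma inVertex_mem (z : Kagome) (j : Fin 2) : z.1 + (3 * sgn j) • inDir z.1 ∈ rubySet := by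
  rw [mem_rubySet]
  rcases kagome_cases z with ⟨h1, h2, h3, -⟩ | ⟨h1, h2, h3, -⟩ | ⟨h1, h2, h3, -⟩ <;>
    fin_cases j <;> rw [h3] <;> simp [sgn] <;> omega

lemma outVertex_mem (z : Kagome) (i : Fin 2) : z.1 + (3 * sgn i) • outDir z.1 ∈ rubySet := by
  rw [mem_rubySet]
  rcases kagome_cases z with ⟨h1, h2, -, h3⟩ | ⟨h1, h2, -, h3⟩ | ⟨h1, h2, -, h3⟩ <;>
    fin_cases i <;> rw [h3] <;> simp [sgn] <;> omega

/-- The two incoming edges at `z`. -/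
noncomputable def inVertex (z : Kagome) (j : Fin 2) : Ruby :=
  ⟨z.1 + (3 * sgn j) • inDir z.1, inVertex_mem z j⟩

/-- The two outgoing edges at `z`; a current coming in on `inVertex z j` is scattered to its left
into `outVertex z i` if `i = j`, and to its right if `i ≠ j`. -/
noncomputable def outVertex (z : Kagome) (i : Fin 2) : Ruby :=
  ⟨z.1 + (3 * sgn i) • outDir z.1, outVertex_mem z i⟩

lemma inVertex_injective : Function.Injective fun p : Kagome × Fin 2 => inVertex p.1 p.2 := by
  rintro ⟨z, j⟩ ⟨z', j'⟩ h
  have h1 := congrArg (fun w : Ruby => w.1.1) h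
  have h2 := congrArg (fun w : Ruby => w.1.2) h
  simp only [inVertex, Prod.fst_add, Prod.snd_add, Prod.smul_fst, Prod.smul_snd,
    smul_eq_mul] at h1 h2
  rcases kagome_cases z with ⟨a1, a2, a3, -⟩ | ⟨a1, a2, a3, -⟩ | ⟨a1, a2, a3, -⟩ <;>
  rcases kagome_cases z' with ⟨b1, b2, b3, -⟩ | ⟨b1, b2, b3, -⟩ | ⟨b1, b2, b3, -⟩ <;>
  rw [a3, b3] at h1 h2 <;> fin_cases j <;> fin_cases j' <;> simp [sgn] at h1 h2 ⊢ <;>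
  first
  | omega
  | exact Subtype.ext (Prod.ext (by omega) (by omega))

lemma outVertex_injective : Function.Injective fun p : Kagome × Fin 2 => outVertex p.1 p.2 := by
  rintro ⟨z, j⟩ ⟨z', j'⟩ h
  have h1 := congrArg (fun w : Ruby => w.1.1) h
  have h2 := congrArg (fun w : Ruby => w.1.2) h
  simp only [outVertex, Prod.fst_add, Prod.snd_add, Prod.smul_fst, Prod.smul_snd,
    smul_eq_mul] at h1 h2
  rcases kagome_cases z with ⟨a1, a2, -, a3⟩ | ⟨a1, a2, -, a3⟩ | ⟨a1, a2, -, a3⟩ <;>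
  rcases kagome_cases z' with ⟨b1, b2, -, b3⟩ | ⟨b1, b2, -, b3⟩ | ⟨b1, b2, -, b3⟩ <;>
  rw [a3, b3] at h1 h2 <;> fin_cases j <;> fin_cases j' <;> simp [sgn] at h1 h2 ⊢ <;>
  first
  | omega
  | exact Subtype.ext (Prod.ext (by omega) (by omega))

lemma inVertex_surjective : Function.Surjective fun p : Kagome × Fin 2 => inVertex p.1 p.2 := by
  rintro ⟨⟨x, y⟩, hw⟩
  have key : ∀ (a b : ℤ) (j : Fin 2) (h : (a, b) ∈ kagomeSet),
      (a, b) + (3 * sgn j) • inDir (a, b) = (x, y) →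
      ∃ p : Kagome × Fin 2, inVertex p.1 p.2 = ⟨(x, y), hw⟩ :=
    fun a b j h e => ⟨(⟨(a, b), h⟩, j), Subtype.ext e⟩
  have k1 : ∀ a b : ℤ, a % 12 = 0 → b % 12 = 0 → (a, b) ∈ kagomeSet := fun a b h h' =>
    Or.inl (Or.inl (mem_kagome₁.2 ⟨h, h'⟩))
  have k2 : ∀ a b : ℤ, a % 12 = 6 → b % 12 = 0 → (a, b) ∈ kagomeSet := fun a b h h' =>
    Or.inl (Or.inr (mem_kagome₂.2 ⟨h, h'⟩))
  have k3 : ∀ a b : ℤ, a % 12 = 0 → b % 12 = 6 → (a, b) ∈ kagomeSet := fun a b h h' =>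
    Or.inr (mem_kagome₃.2 ⟨h, h'⟩)
  rcases mem_rubySet.1 hw with h | h | h | h | h | h <;> simp only at h
  · refine key (x - 3) y 0 (k1 _ _ (by omega) (by omega)) ?_
    rcases kagome_cases ⟨(x - 3, y), k1 _ _ (by omega) (by omega)⟩ with c | c | c <;>
      simp only at c <;> first | omega | (rw [c.2.2.1]; simp [sgn])
  · refine key (x + 3) y 1 (k1 _ _ (by omega) (by omega)) ?_
    rcases kagome_cases ⟨(x + 3, y), k1 _ _ (by omega) (by omega)⟩ with c | c | c <;>
      simp only at c <;> first | omega | (rw [c.2.2.1]; simp [sgn])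
  · refine key x (y + 3) 1 (k3 _ _ (by omega) (by omega)) ?_
    rcases kagome_cases ⟨(x, y + 3), k3 _ _ (by omega) (by omega)⟩ with c | c | c <;>
      simp only at c <;> first | omega | (rw [c.2.2.1]; simp [sgn])
  · refine key x (y - 3) 0 (k3 _ _ (by omega) (by omega)) ?_
    rcases kagome_cases ⟨(x, y - 3), k3 _ _ (by omega) (by omega)⟩ with c | c | c <;>
      simp only at c <;> first | omega | (rw [c.2.2.1]; simp [sgn])
  · refine key (x - 3) (y + 3) 0 (k2 _ _ (by omega) (by omega)) ?_
    rcases kagome_cases ⟨(x - 3, y + 3), k2 _ _ (by omega) (by omega)⟩ with c | c | c <;>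
      simp only at c <;> first | omega | (rw [c.2.2.1]; simp [sgn])
  · refine key (x + 3) (y - 3) 1 (k2 _ _ (by omega) (by omega)) ?_
    rcases kagome_cases ⟨(x + 3, y - 3), k2 _ _ (by omega) (by omega)⟩ with c | c | c <;>
      simp only at c <;> first | omega | (rw [c.2.2.1]; simp [sgn])

lemma outVertex_surjective : Function.Surjective fun p : Kagome × Fin 2 => outVertex p.1 p.2 := by
  rintro ⟨⟨x, y⟩, hw⟩
  have key : ∀ (a b : ℤ) (j : Fin 2) (h : (a, b) ∈ kagomeSet),
      (a, b) + (3 * sgn j) • outDir (a, b) = (x, y) →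
      ∃ p : Kagome × Fin 2, outVertex p.1 p.2 = ⟨(x, y), hw⟩ :=
    fun a b j h e => ⟨(⟨(a, b), h⟩, j), Subtype.ext e⟩
  have k1 : ∀ a b : ℤ, a % 12 = 0 → b % 12 = 0 → (a, b) ∈ kagomeSet := fun a b h h' =>
    Or.inl (Or.inl (mem_kagome₁.2 ⟨h, h'⟩))
  have k2 : ∀ a b : ℤ, a % 12 = 6 → b % 12 = 0 → (a, b) ∈ kagomeSet := fun a b h h' =>
    Or.inl (Or.inr (mem_kagome₂.2 ⟨h, h'⟩))
  have k3 : ∀ a b : ℤ, a % 12 = 0 → b % 12 = 6 → (a, b) ∈ kagomeSet := fun a b h h' =>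
    Or.inr (mem_kagome₃.2 ⟨h, h'⟩)
  rcases mem_rubySet.1 hw with h | h | h | h | h | h <;> simp only at h
  · refine key (x + 3) y 0 (k2 _ _ (by omega) (by omega)) ?_
    rcases kagome_cases ⟨(x + 3, y), k2 _ _ (by omega) (by omega)⟩ with c | c | c <;>
      simp only at c <;> first | omega | (rw [c.2.2.2]; simp [sgn])
  · refine key (x - 3) y 1 (k2 _ _ (by omega) (by omega)) ?_
    rcases kagome_cases ⟨(x - 3, y), k2 _ _ (by omega) (by omega)⟩ with c | c | c <;>
      simp only at c <;> first | omega | (rw [c.2.2.2]; simp [sgn])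
  · refine key x (y - 3) 1 (k1 _ _ (by omega) (by omega)) ?_
    rcases kagome_cases ⟨(x, y - 3), k1 _ _ (by omega) (by omega)⟩ with c | c | c <;>
      simp only at c <;> first | omega | (rw [c.2.2.2]; simp [sgn])
  · refine key x (y + 3) 0 (k1 _ _ (by omega) (by omega)) ?_
    rcases kagome_cases ⟨(x, y + 3), k1 _ _ (by omega) (by omega)⟩ with c | c | c <;>
      simp only at c <;> first | omega | (rw [c.2.2.2]; simp [sgn])
  · refine key (x + 3) (y - 3) 1 (k3 _ _ (by omega) (by omega)) ?_
    rcases kagome_cases ⟨(x + 3, y - 3), k3 _ _ (by omega) (by omega)⟩ with c | c | c <;>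
      simp only at c <;> first | omega | (rw [c.2.2.2]; simp [sgn])
  · refine key (x - 3) (y + 3) 0 (k3 _ _ (by omega) (by omega)) ?_
    rcases kagome_cases ⟨(x - 3, y + 3), k3 _ _ (by omega) (by omega)⟩ with c | c | c <;>
      simp only at c <;> first | omega | (rw [c.2.2.2]; simp [sgn])

/-- Every Ruby vertex is incoming to exactly one Kagome vertex. -/
noncomputable def inEquiv : Kagome × Fin 2 ≃ Ruby :=
  Equiv.ofBijective _ ⟨inVertex_injective, inVertex_surjective⟩

/-- Every Ruby vertex is outgoing from exactly one Kagome vertex. -/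
noncomputable def outEquiv : Kagome × Fin 2 ≃ Ruby :=
  Equiv.ofBijective _ ⟨outVertex_injective, outVertex_surjective⟩

/-! ## The unitary operator of the model -/

/-- The Hilbert space `ℓ²(Ruby; ℂ)`. -/
abbrev Ell2 : Type := lp (fun _ : Ruby => ℂ) 2

open Classical in
/-- The canonical basis vector `|w⟩`. -/
noncomputable def ket (w : Ruby) : Ell2 := lp.single 2 w (1 : ℂ)

/-- A collection of scattering matrices `S_z ∈ U(2)`. -/
abbrev ScatteringMatrices : Type := Kagome → Matrix.unitaryGroup (Fin 2) ℂ

/-- The image of the basis vector `|w⟩` under the evolution: if `w = inVertex z j`, it is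
`∑ i, (S_z)_{i j} |outVertex z i⟩`. -/
noncomputable def column (S : ScatteringMatrices) (w : Ruby) : Ell2 :=
  ∑ i, ((S (inEquiv.symm w).1).1 i (inEquiv.symm w).2) • ket (outVertex (inEquiv.symm w).1 i)

lemma inner_ket (w : Ruby) (ψ : Ell2) : inner ℂ (ket w) ψ = ψ w := by
  classical
  simp [ket, lp.inner_single_left]

lemma ket_apply (w x : Ruby) [Decidable (x = w)] : ket w x = if x = w then 1 else 0 := by
  classical
  by_cases h : x = w
  · subst h; simp [ket]
  · simp [ket, h]

lemma inner_column (S : ScatteringMatrices) (z : Kagome) (j : Fin 2) (ψ : Ell2) :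
    inner ℂ (column S (inVertex z j)) ψ = ∑ i, star ((S z).1 i j) * ψ (outVertex z i) := by
  have h : inEquiv.symm (inVertex z j) = (z, j) := inEquiv.symm_apply_apply (z, j)
  simp [column, h, inner_ket, mul_comm]

lemma column_apply (S : ScatteringMatrices) (z z' : Kagome) (j i : Fin 2) [Decidable (z' = z)] :
    column S (inVertex z j) (outVertex z' i) = if z' = z then (S z).1 i j else 0 := by
  classical
  have h : inEquiv.symm (inVertex z j) = (z, j) := inEquiv.symm_apply_apply (z, j)
  have h2 : ∀ k, (outVertex z' i = outVertex z k) ↔ (z' = z ∧ i = k) := fun k => by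
    have := outVertex_injective.eq_iff (a := (z', i)) (b := (z, k))
    simpa using this
  simp only [column, h, Fin.sum_univ_two, lp.coeFn_add, lp.coeFn_smul, Pi.add_apply, Pi.smul_apply,
    ket_apply, h2, smul_eq_mul]
  by_cases hz : z' = z
  · fin_cases i <;> simp [hz]
  · simp [hz]

lemma orthonormal_column (S : ScatteringMatrices) : Orthonormal ℂ (column S) := by
  classical
  rw [orthonormal_iff_ite]
  intro w w'
  obtain ⟨⟨z, j⟩, rfl⟩ := inVertex_surjective w
  obtain ⟨⟨z', j'⟩, rfl⟩ := inVertex_surjective w'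
  simp only
  rw [inner_column]
  simp only [column_apply]
  have hS := congrFun (congrFun (Matrix.mem_unitaryGroup_iff'.1 (S z).2) j) j'
  have e : (inVertex z j = inVertex z' j') ↔ (z = z' ∧ j = j') := by
    have := inVertex_injective.eq_iff (a := (z, j)) (b := (z', j'))
    simpa using this
  rw [if_congr e rfl rfl]
  by_cases h : z = z'
  · subst h
    simpa [Matrix.mul_apply, Matrix.one_apply, Matrix.star_apply] using hS
  · simp [h]

lemma orthogonal_column (S : ScatteringMatrices) :
    (Submodule.span ℂ (Set.range (column S)))ᗮ = ⊥ := by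
  rw [Submodule.eq_bot_iff]
  intro ψ hψ
  have h0 : ∀ z, (star (S z).1).mulVec (fun i => ψ (outVertex z i)) = 0 := by
    intro z
    funext j
    have := (Submodule.mem_orthogonal _ _).1 hψ (column S (inVertex z j))
      (Submodule.subset_span ⟨_, rfl⟩)
    rw [inner_column] at this
    simpa [Matrix.mulVec, dotProduct, Matrix.star_apply] using this
  have h1 : ∀ z i, ψ (outVertex z i) = 0 := by
    intro z i
    have := congrArg (fun v => (S z).1.mulVec v) (h0 z)
    simp only [Matrix.mulVec_mulVec, Matrix.mulVec_zero, Matrix.mem_unitaryGroup_iff.1 (S z).2,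
      Matrix.one_mulVec] at this
    exact congrFun this i
  ext w
  obtain ⟨⟨z, i⟩, rfl⟩ := outVertex_surjective w
  exact h1 z i

/-- The unitary operator of the Chalker-Coddington model: `U |w⟩ = column S w` for all `w`, that is,
`U |inVertex z j⟩ = ∑ i, (S_z)_{i j} |outVertex z i⟩`. -/
noncomputable def evolution (S : ScatteringMatrices) : Ell2 ≃ₗᵢ[ℂ] Ell2 :=
  (HilbertBasis.mkOfOrthogonalEqBot (orthonormal_column S) (orthogonal_column S)).repr.symm

lemma evolution_ket (S : ScatteringMatrices) (z : Kagome) (j : Fin 2) :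
    evolution S (ket (inVertex z j)) = ∑ i, ((S z).1 i j) • ket (outVertex z i) := by
  classical
  have h : inEquiv.symm (inVertex z j) = (z, j) := inEquiv.symm_apply_apply (z, j)
  have h2 : ket (inVertex z j) = lp.single 2 (inVertex z j) (1 : ℂ) := by
    simp only [ket]
  rw [evolution, h2, HilbertBasis.repr_symm_single, HilbertBasis.coe_mkOfOrthogonalEqBot, column, h]

/-- The weight `|⟨y, U x⟩|` of the edge from `x` to `y`. -/
noncomputable def weight (S : ScatteringMatrices) (x y : Ruby) : ℝ :=
  ‖inner ℂ (ket y) (evolution S (ket x))‖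

/-- `|r_z|`: the weight of scattering to the left at `z`. By unitarity of `S_z` the two incoming
edges give the same value. -/
noncomputable def rAbs (S : ScatteringMatrices) (z : Kagome) : ℝ :=
  weight S (inVertex z 0) (outVertex z 0)

/-! ## The flux operator and its index -/

/-- The multiplication operator by the indicator function of `M`. -/
noncomputable def proj (M : Set Ruby) : Ell2 →L[ℂ] Ell2 :=
  LinearMap.mkContinuous
    { toFun := fun ψ => ⟨M.indicator fun x => ψ x, (lp.memℓp ψ).mono' fun x => by
        by_cases h : x ∈ M <;> simp [h]⟩
      map_add' := fun ψ φ => by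
        ext x
        change M.indicator (fun x => ψ x + φ x) x =
          M.indicator (fun x => ψ x) x + M.indicator (fun x => φ x) x
        by_cases h : x ∈ M <;> simp [h]
      map_smul' := fun c ψ => by
        ext x
        by_cases h : x ∈ M <;> simp [Set.indicator, h] } 1 fun ψ => by
    rw [one_mul]
    refine lp.norm_mono (by norm_num) fun x => ?_
    by_cases h : x ∈ M <;> simp [h]

/-- The flux operator `Φ = U* P U - P` with `P = χ(x ∈ M)`. -/
noncomputable def flux (S : ScatteringMatrices) (M : Set Ruby) : Ell2 →L[ℂ] Ell2 :=
  ContinuousLinearMap.adjoint ((evolution S).toContinuousLinearEquiv : Ell2 →L[ℂ] Ell2) ∘L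
    proj M ∘L ((evolution S).toContinuousLinearEquiv : Ell2 →L[ℂ] Ell2) - proj M

/-- `ind(Φ)` is defined: `1` is an isolated eigenvalue of finite multiplicity of `Φ²`. -/
def IndexDefined (Φ : Ell2 →L[ℂ] Ell2) : Prop :=
  Module.End.HasEigenvalue ((Φ ^ 2 : Ell2 →L[ℂ] Ell2) : Module.End ℂ Ell2) 1 ∧
  FiniteDimensional ℂ (Module.End.eigenspace ((Φ ^ 2 : Ell2 →L[ℂ] Ell2) : Module.End ℂ Ell2) 1) ∧
  ∃ ε > 0, ∀ μ ∈ spectrum ℂ (Φ ^ 2), μ ≠ 1 → ε ≤ ‖μ - 1‖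

/-- `ind(Φ) = dim ker(Φ - 1) - dim ker(Φ + 1)`. -/
noncomputable def index (Φ : Ell2 →L[ℂ] Ell2) : ℤ :=
  (Module.finrank ℂ (LinearMap.ker ((Φ - 1 : Ell2 →L[ℂ] Ell2) : Ell2 →ₗ[ℂ] Ell2)) : ℤ) -
    Module.finrank ℂ (LinearMap.ker ((Φ + 1 : Ell2 →L[ℂ] Ell2) : Ell2 →ₗ[ℂ] Ell2))

/-! ## Half spaces and admissible paths -/

/-- The directed edges of the Ruby graph, from the incoming to the outgoing vertices at each
Kagome vertex. -/
def IsEdge (x y : Ruby) : Prop := ∃ z i j, x = inVertex z j ∧ y = outVertex z i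

/-- The undirected graph underlying the Ruby graph. -/
def rubyGraph : SimpleGraph Ruby := SimpleGraph.fromRel IsEdge

/-- The edge from `inVertex z j` to `outVertex z i` belongs to the boundary of the rectangle with
centre `z` and of one other face, a hexagon if `i = j` and a triangle if `i ≠ j`; this is the
centre of that other face. -/
noncomputable def otherFace (z : Kagome) (i j : Fin 2) : ℤ × ℤ :=
  z.1 + (if i = j then (6 : ℤ) else 2) • (sgn j • inDir z.1 + sgn i • outDir z.1)

/-- The segment between the points `f` and `g` is a link, namely the one that bisects the directed
edge `x y`; its endpoints are the centres of the two faces adjacent to that edge. -/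
def Bisects (f g : ℤ × ℤ) (x y : Ruby) : Prop :=
  ∃ z i j, x = inVertex z j ∧ y = outVertex z i ∧
    ((f = z.1 ∧ g = otherFace z i j) ∨ (g = z.1 ∧ f = otherFace z i j))

/-- The point `x` lies to the left of the oriented line from `f` to `g`. -/
def LeftOf (f g x : ℤ × ℤ) : Prop :=
  0 < (g.1 - f.1) * (x.2 - f.2) - (g.2 - f.2) * (x.1 - f.1)

/-- `γ` is an admissible path and `M` the set of vertices of the subgraph `G₊` to its left. -/
structure IsAdmissible (γ : ℤ → ℤ × ℤ) (M : Set Ruby) : Prop where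
  infinite : M.Infinite
  infinite_compl : Mᶜ.Infinite
  connected : (rubyGraph.induce M).Connected
  connected_compl : (rubyGraph.induce Mᶜ).Connected
  injective : Function.Injective γ
  mem_dual : ∀ t, γ t ∈ dualVertices
  link : ∀ t, ∃ x y, Bisects (γ t) (γ (t + 1)) x y
  boundary : ∀ x y, IsEdge x y →
    ((∃ t, Bisects (γ t) (γ (t + 1)) x y) ↔ ¬ (x ∈ M ↔ y ∈ M))
  left : ∀ t x y, Bisects (γ t) (γ (t + 1)) x y →
    (LeftOf (γ t) (γ (t + 1)) x.1 ↔ x ∈ M) ∧ (LeftOf (γ t) (γ (t + 1)) y.1 ↔ y ∈ M)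

end RubyCC

namespace RubyCC

/-! ## Operators acting on `ℓ²` by multiplication -/

/-! One explicit path serves every model. The flux operator is a direct sum over the Kagome vertices
`z` of 2×2 blocks acting on the span of the two incoming vertices, and the block at `z` depends only
on which of the four corners of the rectangle at `z` lie in the half space.

If all or none of the corners lie in it, the block vanishes. If the path crosses the rectangle
through two opposite edges, the half space contains one incoming and one outgoing corner; the block
is a difference of two rank-one projections, and its square is the scalar `1 - |s|²`, where `s` is
the amplitude of the uncut edge joining them. A passage from hexagon to hexagon gives `|r_z|²`, one
from triangle to triangle gives `1 - |r_z|²`; both stay uniformly below `1`. If the path turns, from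
a hexagon to a triangle, it cuts off a single corner. When this is an incoming corner below the
path, the block is exactly the projection to it, whatever `S_z` is.

The path `pathPoint` therefore runs along hexagons, turns once, at `(0, 6)`, and continues along
triangles. The square of its flux operator is diagonal, equal to `1` at one basis vector, which the
flux operator fixes, and at most some `c < 1` elsewhere, so the index is `1`.

The analysis is in `indexDefined_of_sq` and `index_of_sq`, the blocks in `flux_sq_apply_of_one`,
`flux_apply_of_forall` and `flux_apply_of_forall_out`, the geometry in `isAdmissible_pathPoint` and
`region_upper_balanced`. -/

lemma norm_le_of_apply {T : Ell2 →L[ℂ] Ell2} {τ : Ruby → ℂ} {c : ℝ} (hc : 0 ≤ c)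
    (hT : ∀ ψ x, T ψ x = τ x * ψ x) (hτ : ∀ x, ‖τ x‖ ≤ c) : ‖T‖ ≤ c := by
  refine T.opNorm_le_bound hc fun ψ => ?_
  have h := lp.norm_mono (p := 2) (by norm_num) (x := T ψ) (y := (c : ℂ) • ψ) fun x => by
    rw [hT, norm_mul, lp.coeFn_smul, Pi.smul_apply, norm_smul, Complex.norm_real,
      Real.norm_of_nonneg hc]
    exact mul_le_mul_of_nonneg_right (hτ x) (norm_nonneg (ψ x))
  rwa [norm_smul, Complex.norm_real, Real.norm_of_nonneg hc] at h

lemma proj_apply (M : Set Ruby) (ψ : Ell2) (x : Ruby) [Decidable (x ∈ M)] :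
    proj M ψ x = if x ∈ M then ψ x else 0 := by
  change M.indicator (fun x => ψ x) x = _
  by_cases h : x ∈ M <;> simp [h]

lemma isIdempotentElem_proj (M : Set Ruby) : IsIdempotentElem (proj M) := by
  classical
  ext ψ x
  rw [mul_apply_eq_comp, proj_apply, proj_apply]
  split_ifs <;> rfl

/-- The spectrum of a sum of mutually orthogonal operators, one of them idempotent. -/
lemma mem_spectrum_add_of_isIdempotentElem {A : Type*} [Ring A] [Algebra ℂ A] {E T : A}
    (hE : IsIdempotentElem E) (hET : E * T = 0) {μ : ℂ} (hμ : μ ∈ spectrum ℂ (E + T))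
    (h0 : μ ≠ 0) (h1 : μ ≠ 1) : μ ∈ spectrum ℂ T := by
  by_contra hT
  have hE' : μ ∉ spectrum ℂ E := fun h => by
    have := hE.spectrum_subset ℂ h
    simp_all
  rw [spectrum.mem_iff, not_not] at hE' hT
  refine hμ ?_
  -- Since `E * T = 0`, the product `(μ - E)(μ - T)` equals `μ (μ - (E + T))`. Both factors are
  -- invertible, the first because the spectrum of an idempotent lies in `{0, 1}`.
  have key : algebraMap ℂ A μ - (E + T) =
      algebraMap ℂ A μ⁻¹ * ((algebraMap ℂ A μ - E) * (algebraMap ℂ A μ - T)) := by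
    have e : (algebraMap ℂ A μ - E) * (algebraMap ℂ A μ - T) =
        algebraMap ℂ A μ * (algebraMap ℂ A μ - (E + T)) := by
      rw [mul_sub, sub_mul, sub_mul, hET, mul_sub, mul_add, ← Algebra.commutes μ E]
      abel
    rw [e, ← mul_assoc, ← map_mul, inv_mul_cancel₀ h0, map_one, one_mul]
  change IsUnit _
  rw [key]
  exact ((isUnit_iff_ne_zero.2 (inv_ne_zero h0)).map (algebraMap ℂ A)).mul (hE'.mul hT)

/-! ### Index of an operator whose square is diagonal -/

section

variable {Φ : Ell2 →L[ℂ] Ell2} {τ : Ruby → ℂ} {c : ℝ} {w : Ruby}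

lemma eq_smul_ket {ψ : Ell2} (h : ∀ x, x ≠ w → ψ x = 0) : ψ = ψ w • ket w := by
  classical
  ext x
  rw [lp.coeFn_smul, Pi.smul_apply, ket_apply]
  by_cases hx : x = w
  · simp [hx]
  · simp [hx, h x hx]

lemma ket_ne_zero (w : Ruby) : ket w ≠ 0 := fun h => by
  classical
  have := ket_apply w w
  simp [h] at this

/-- Off `w` the multiplier differs from `1`. The kernels of `Φ - 1` and `Φ + 1` both consist of
fixed vectors of `Φ ^ 2`, so this confines both to the line of `ket w`. -/
lemma apply_eq_zero_of_sq (hτ : ∀ ψ x, (Φ ^ 2) ψ x = τ x * ψ x)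
    (hc : ∀ x, x ≠ w → ‖τ x‖ ≤ c) (hc1 : c < 1) {ψ : Ell2} (hψ : (Φ ^ 2) ψ = ψ) (x : Ruby)
    (hx : x ≠ w) : ψ x = 0 := by
  have h := hτ ψ x
  rw [hψ] at h
  by_contra h0
  have : τ x = 1 := by
    have : (τ x - 1) * ψ x = 0 := by rw [sub_mul, ← h]; ring
    rcases mul_eq_zero.1 this with h | h
    · exact sub_eq_zero.1 h
    · exact absurd h h0
  have := hc x hx
  simp_all
  linarith

/-- If `Φ |w⟩ = |w⟩` and `Φ²` is multiplication by a function which is uniformly smaller than `1`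
outside of `w`, then the index of `Φ` is defined. -/
lemma indexDefined_of_sq (hτ : ∀ ψ x, (Φ ^ 2) ψ x = τ x * ψ x) (hw : Φ (ket w) = ket w)
    (hc : ∀ x, x ≠ w → ‖τ x‖ ≤ c) (hc0 : 0 < c) (hc1 : c < 1) : IndexDefined Φ := by
  classical
  have hw2 : (Φ ^ 2) (ket w) = ket w := by
    rw [pow_two, mul_apply_eq_comp, hw, hw]
  have hτw : τ w = 1 := by
    have := hτ (ket w) w
    rw [hw2, ket_apply, if_pos rfl, mul_one] at this
    exact this.symm
  refine ⟨?_, ?_, 1 - c, by linarith, ?_⟩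
  · refine Module.End.hasEigenvalue_of_hasEigenvector (x := ket w) ⟨?_, ket_ne_zero w⟩
    rw [Module.End.mem_eigenspace_iff, one_smul]
    exact hw2
  · refine Submodule.finiteDimensional_of_le (S₂ := Submodule.span ℂ {ket w}) fun ψ hψ => ?_
    rw [Module.End.mem_eigenspace_iff, one_smul] at hψ
    rw [eq_smul_ket (apply_eq_zero_of_sq hτ hc hc1 hψ)]
    exact Submodule.smul_mem _ _ (Submodule.mem_span_singleton_self _)
  · intro μ hμ h1
    by_cases hle : ‖μ‖ ≤ c
    · have := norm_sub_norm_le (1 : ℂ) μ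
      rw [norm_one, norm_sub_rev] at this
      linarith
    -- No spectral value other than `1` has norm above `c`: removing the projection to `w` from `Φ ^
    -- 2` leaves an operator of norm at most `c`, orthogonal to that projection.
    · have hT : ∀ ψ x, (Φ ^ 2 - proj {w}) ψ x = (if x = w then 0 else τ x) * ψ x := by
        intro ψ x
        rw [sub_apply, lp.coeFn_sub, Pi.sub_apply, hτ, proj_apply]
        by_cases hx : x = w
        · simp [hx, hτw]
        · simp [hx]
      have hET : proj {w} * (Φ ^ 2 - proj {w}) = 0 := by
        ext ψ x
        rw [mul_apply_eq_comp, proj_apply, hT]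
        by_cases hx : x = w <;> simp [hx]
      have hμ' : μ ∈ spectrum ℂ (proj {w} + (Φ ^ 2 - proj {w})) := by
        rwa [add_sub_cancel]
      have h2 := mem_spectrum_add_of_isIdempotentElem (isIdempotentElem_proj {w}) hET hμ'
        (fun h0 => hle (by rw [h0, norm_zero]; exact hc0.le)) h1
      have : Nontrivial Ell2 := ⟨⟨ket w, 0, ket_ne_zero w⟩⟩
      exact absurd ((spectrum.norm_le_norm_of_mem h2).trans (norm_le_of_apply hc0.le hT fun x => by
        by_cases hx : x = w
        · simp [hx, hc0.le]
        · simpa [hx] using hc x hx)) hle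

/-- Both kernels lie in the line of `ket w`, on which `Φ` is the identity: one kernel is the whole
line and the other is zero. -/
lemma index_of_sq (hτ : ∀ ψ x, (Φ ^ 2) ψ x = τ x * ψ x) (hw : Φ (ket w) = ket w)
    (hc : ∀ x, x ≠ w → ‖τ x‖ ≤ c) (hc1 : c < 1) : index Φ = 1 := by
  have h1 : LinearMap.ker ((Φ - 1 : Ell2 →L[ℂ] Ell2) : Ell2 →ₗ[ℂ] Ell2) =
      Submodule.span ℂ {ket w} := by
    refine le_antisymm (fun ψ hψ => ?_) ?_
    · have h : Φ ψ = ψ := sub_eq_zero.1 hψ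
      rw [eq_smul_ket (apply_eq_zero_of_sq hτ hc hc1 (ψ := ψ)
        (by rw [pow_two, mul_apply_eq_comp, h, h]))]
      exact Submodule.smul_mem _ _ (Submodule.mem_span_singleton_self _)
    · rw [Submodule.span_singleton_le_iff_mem]
      exact sub_eq_zero.2 hw
  have h2 : LinearMap.ker ((Φ + 1 : Ell2 →L[ℂ] Ell2) : Ell2 →ₗ[ℂ] Ell2) = ⊥ := by
    rw [Submodule.eq_bot_iff]
    intro ψ hψ
    have h : Φ ψ = -ψ := eq_neg_of_add_eq_zero_left hψ
    have e := eq_smul_ket (apply_eq_zero_of_sq hτ hc hc1 (ψ := ψ)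
      (by rw [pow_two, mul_apply_eq_comp, h, map_neg, h, neg_neg]))
    have h' : Φ ψ = ψ := by
      rw [e, map_smul, hw]
    have h2 : (2 : ℂ) • ψ = 0 := by
      rw [two_smul]
      nth_rewrite 1 [← h']
      rw [h, neg_add_cancel]
    exact (smul_eq_zero.1 h2).resolve_left two_ne_zero
  rw [index, h1, h2, finrank_span_singleton (ket_ne_zero w), finrank_bot]
  norm_num

end

/-! ## The flux operator in coordinates -/

lemma adjoint_evolution_apply (S : ScatteringMatrices) (z : Kagome) (j : Fin 2) (φ : Ell2) :
    ContinuousLinearMap.adjoint ((evolution S).toContinuousLinearEquiv : Ell2 →L[ℂ] Ell2) φ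
      (inVertex z j) = ∑ i, star ((S z).1 i j) * φ (outVertex z i) := by
  rw [← inner_ket, ContinuousLinearMap.adjoint_inner_right, ← inner_column]
  congr 1
  have h : inEquiv.symm (inVertex z j) = (z, j) := inEquiv.symm_apply_apply (z, j)
  rw [column, h]
  exact evolution_ket S z j

lemma evolution_apply (S : ScatteringMatrices) (z : Kagome) (i : Fin 2) (ψ : Ell2) :
    evolution S ψ (outVertex z i) = ∑ j, (S z).1 i j * ψ (inVertex z j) := by
  -- This is `ψ = U* U ψ` in coordinates. Applying `S_z` to it and using `S_z S_z* = 1` isolates the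
  -- coordinates of `U ψ` without expanding `ψ` in a basis.
  have h : ∀ k, ψ (inVertex z k) =
      ∑ i, star ((S z).1 i k) * evolution S ψ (outVertex z i) := by
    intro k
    rw [← inner_ket, ← (evolution S).inner_map_map, evolution_ket, ← inner_column]
    congr 1
    have h : inEquiv.symm (inVertex z k) = (z, k) := inEquiv.symm_apply_apply (z, k)
    rw [column, h]
  have hS := Matrix.mem_unitaryGroup_iff.1 (S z).2
  have h1 : ∀ l, ∑ k, (S z).1 i k * star ((S z).1 l k) = if i = l then 1 else 0 :=
    fun l => by rw [← Matrix.one_apply, ← hS]; simp [Matrix.mul_apply, Matrix.star_apply]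
  have h10 := h1 0
  have h11 := h1 1
  simp only [h, Fin.sum_univ_two] at h10 h11 ⊢
  fin_cases i <;> simp at h10 h11 ⊢ <;>
    linear_combination (-evolution S ψ (outVertex z 0)) * h10 -
      (evolution S ψ (outVertex z 1)) * h11

/-- The block decomposition: only the values of `ψ` at the two vertices incoming to `z` enter,
through `S_z* D S_z - D'` with diagonal 0-1 matrices `D`, `D'` that record membership in `M` of the
outgoing and incoming vertices. -/
lemma flux_apply (S : ScatteringMatrices) (M : Set Ruby) (z : Kagome) (k : Fin 2) (ψ : Ell2)
    [DecidablePred (· ∈ M)] :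
    flux S M ψ (inVertex z k) =
      (∑ i, star ((S z).1 i k) * if outVertex z i ∈ M then
        ∑ j, (S z).1 i j * ψ (inVertex z j) else 0) -
      if inVertex z k ∈ M then ψ (inVertex z k) else 0 := by
  simp only [flux, sub_apply, lp.coeFn_sub, Pi.sub_apply,
    ContinuousLinearMap.comp_apply, adjoint_evolution_apply, proj_apply]
  congr 1
  refine Finset.sum_congr rfl fun i _ => ?_
  congr 2
  exact evolution_apply S z i ψ

/-- If `M` contains one incoming and one outgoing vertex at `z`, the square of the flux operator
at `z` is multiplication by `1 - |⟨outVertex z i, U (inVertex z j)⟩|²`. -/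
lemma flux_sq_apply_of_one (S : ScatteringMatrices) (M : Set Ruby) (z : Kagome) (i j : Fin 2)
    (ho : ∀ k, outVertex z k ∈ M ↔ k = i) (hi : ∀ k, inVertex z k ∈ M ↔ k = j) (ψ : Ell2)
    (k : Fin 2) :
    (flux S M ^ 2) ψ (inVertex z k) = (1 - ‖(S z).1 i j‖ ^ 2 : ℝ) * ψ (inVertex z k) := by
  classical
  have hS := congrFun (congrFun (Matrix.mem_unitaryGroup_iff.1 (S z).2) i) i
  simp only [Matrix.mul_apply, Matrix.star_apply, Fin.sum_univ_two, Matrix.one_apply_eq] at hS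
  have hn : ((‖(S z).1 i j‖ ^ 2 : ℝ) : ℂ) = star ((S z).1 i j) * (S z).1 i j := by
    rw [mul_comm]
    push_cast
    exact (Complex.mul_conj' _).symm
  rw [pow_two, mul_apply_eq_comp]
  simp only [flux_apply, ho, hi, Fin.sum_univ_two, Complex.ofReal_sub, hn, Complex.ofReal_one]
  -- The block is the projection to the conjugate of row `i` of `S_z` minus the projection to
  -- coordinate `j`. That its square is scalar uses only that row `i` has norm one.
  have key (l : Fin 2) := congrArg (fun t => star ((S z).1 i l) *
    ((S z).1 i 0 * ψ (inVertex z 0) + (S z).1 i 1 * ψ (inVertex z 1)) * t) hS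
  by_cases hk : k = j
  · have h := key k
    fin_cases i <;> fin_cases j <;> fin_cases k <;> simp at hk h ⊢ <;> linear_combination h
  · have h := key k
    have h' := congrArg (fun t => ψ (inVertex z k) * t) hS
    fin_cases i <;> fin_cases j <;> fin_cases k <;> simp at hk h h' ⊢ <;>
      linear_combination h + h'

/-- The indicator is the same constant on the outgoing and the incoming pair, and conjugation by the
unitary `S_z` preserves constants. -/
lemma flux_apply_of_forall (S : ScatteringMatrices) (M : Set Ruby) (z : Kagome) (p : Prop)
    (ho : ∀ k, outVertex z k ∈ M ↔ p) (hi : ∀ k, inVertex z k ∈ M ↔ p) (ψ : Ell2) (k : Fin 2) :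
    flux S M ψ (inVertex z k) = 0 := by
  classical
  have hS := fun l => congrFun (congrFun (Matrix.mem_unitaryGroup_iff'.1 (S z).2) k) l
  have h0 := hS 0
  have h1 := hS 1
  simp only [Matrix.mul_apply, Matrix.star_apply, Fin.sum_univ_two, Matrix.one_apply] at h0 h1
  simp only [flux_apply, ho, hi, Fin.sum_univ_two]
  by_cases hp : p
  · simp only [hp, if_true]
    fin_cases k <;> simp at h0 h1 ⊢ <;>
      linear_combination ψ (inVertex z 0) * h0 + ψ (inVertex z 1) * h1
  · simp [hp]

/-- If `M` contains both outgoing vertices at `z` but only one of the incoming ones, then the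
flux operator at `z` is the projection to the other one. -/
lemma flux_apply_of_forall_out (S : ScatteringMatrices) (M : Set Ruby) (z : Kagome)
    (ho : ∀ k, outVertex z k ∈ M) (ψ : Ell2) (k : Fin 2) [Decidable (inVertex z k ∈ M)] :
    flux S M ψ (inVertex z k) = if inVertex z k ∈ M then 0 else ψ (inVertex z k) := by
  classical
  have hS := fun l => congrFun (congrFun (Matrix.mem_unitaryGroup_iff'.1 (S z).2) k) l
  have h0 := hS 0
  have h1 := hS 1
  simp only [Matrix.mul_apply, Matrix.star_apply, Fin.sum_univ_two, Matrix.one_apply] at h0 h1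
  simp only [flux_apply, ho, Fin.sum_univ_two, if_true]
  split_ifs <;> fin_cases k <;> simp at h0 h1 ⊢ <;>
      linear_combination ψ (inVertex z 0) * h0 + ψ (inVertex z 1) * h1

/-! ## A half space -/

/-- The region above the path `pathPoint`. -/
def Upper (x y : ℤ) : Prop := (x ≤ 0 ∧ 9 ≤ y) ∨ (0 < x ∧ (3 ≤ y ∨ (y = 0 ∧ x % 12 = 9)))

/-- The Ruby vertices whose coordinates satisfy `P`. -/
def region (P : ℤ → ℤ → Prop) : Set Ruby := {w | P w.1.1 w.1.2}

/-- `(x, y)` is incoming and `(x', y')` is outgoing at the Kagome vertex `(a, b)`. -/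
def Corner (a b x y x' y' : ℤ) : Prop :=
  (a % 12 = 0 ∧ b % 12 = 0 ∧ (x = a + 3 ∨ x = a - 3) ∧ y = b ∧ x' = a ∧
    (y' = b + 3 ∨ y' = b - 3)) ∨
  (a % 12 = 6 ∧ b % 12 = 0 ∧ (x = a + 3 ∧ y = b - 3 ∨ x = a - 3 ∧ y = b + 3) ∧
    (x' = a + 3 ∨ x' = a - 3) ∧ y' = b) ∨
  (a % 12 = 0 ∧ b % 12 = 6 ∧ x = a ∧ (y = b + 3 ∨ y = b - 3) ∧
    (x' = a + 3 ∧ y' = b - 3 ∨ x' = a - 3 ∧ y' = b + 3))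

lemma kagome_mem {a b : ℤ} (h : a % 12 = 0 ∧ b % 12 = 0 ∨ a % 12 = 6 ∧ b % 12 = 0 ∨
    a % 12 = 0 ∧ b % 12 = 6) : (a, b) ∈ kagomeSet := by
  rcases h with h | h | h
  · exact Or.inl (Or.inl (mem_kagome₁.2 h))
  · exact Or.inl (Or.inr (mem_kagome₂.2 h))
  · exact Or.inr (mem_kagome₃.2 h)

lemma Corner.isEdge {a b x y x' y' : ℤ} (h : Corner a b x y x' y') (hx : (x, y) ∈ rubySet)
    (hx' : (x', y') ∈ rubySet) : IsEdge ⟨(x, y), hx⟩ ⟨(x', y'), hx'⟩ := by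
  have hz : (a, b) ∈ kagomeSet := kagome_mem (by unfold Corner at h; omega)
  have key : ∃ j i : Fin 2, (x, y) = (a, b) + (3 * sgn j) • inDir (a, b) ∧
      (x', y') = (a, b) + (3 * sgn i) • outDir (a, b) := by
    rcases kagome_cases ⟨(a, b), hz⟩ with c | c | c <;> simp only at c <;>
      obtain ⟨c1, c2, c3, c4⟩ := c <;> rw [c3, c4] <;> unfold Corner at h <;>
      simp [Fin.exists_fin_two, sgn] <;> omega
  obtain ⟨j, i, h1, h2⟩ := key
  exact ⟨⟨(a, b), hz⟩, i, j, Subtype.ext h1, Subtype.ext h2⟩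

/-- The points `(x, y)` and `(x', y')` are joined by a path in the region `P`. -/
def Joined (P : ℤ → ℤ → Prop) (x y x' y' : ℤ) : Prop :=
  ∃ (h : (x, y) ∈ rubySet) (h' : (x', y') ∈ rubySet) (hP : P x y) (hP' : P x' y'),
    (rubyGraph.induce (region P)).Reachable ⟨⟨(x, y), h⟩, hP⟩ ⟨⟨(x', y'), h'⟩, hP'⟩

/-! ### Connectedness and infinitude of the two sides -/

section

variable {P : ℤ → ℤ → Prop} {x y x' y' x'' y'' : ℤ}

lemma Joined.symm (h : Joined P x y x' y') : Joined P x' y' x y := by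
  obtain ⟨h1, h2, h3, h4, h5⟩ := h
  exact ⟨h2, h1, h4, h3, h5.symm⟩

lemma Joined.trans (h : Joined P x y x' y') (h' : Joined P x' y' x'' y'') :
    Joined P x y x'' y'' := by
  obtain ⟨h1, h2, h3, h4, h5⟩ := h
  obtain ⟨h1', h2', h3', h4', h5'⟩ := h'
  exact ⟨h1, h2', h3, h4', h5.trans h5'⟩

lemma Corner.joined (a b : ℤ) (h : Corner a b x y x' y') (hP : P x y) (hP' : P x' y') :
    Joined P x y x' y' := by
  have hx : (x, y) ∈ rubySet := by rw [mem_rubySet]; unfold Corner at h; simp only; omega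
  have hx' : (x', y') ∈ rubySet := by rw [mem_rubySet]; unfold Corner at h; simp only; omega
  refine ⟨hx, hx', hP, hP', SimpleGraph.Adj.reachable ?_⟩
  rw [SimpleGraph.comap_adj]
  refine (SimpleGraph.fromRel_adj _ _ _).2 ⟨fun e => ?_, Or.inl (h.isEdge hx hx')⟩
  have e1 := congrArg (fun w : Ruby => w.1.1) e
  have e2 := congrArg (fun w : Ruby => w.1.2) e
  unfold Corner at h
  simp at e1 e2
  omega

lemma connected_of_joined (x₀ y₀ : ℤ) (h₀ : (x₀, y₀) ∈ rubySet) (hP₀ : P x₀ y₀)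
    (h : ∀ x y, (x, y) ∈ rubySet → P x y → Joined P x y x₀ y₀) :
    (rubyGraph.induce (region P)).Connected := by
  rw [SimpleGraph.connected_iff_exists_forall_reachable]
  refine ⟨⟨⟨(x₀, y₀), h₀⟩, hP₀⟩, ?_⟩
  rintro ⟨⟨⟨x, y⟩, hw⟩, hP⟩
  obtain ⟨_, _, _, _, h5⟩ := h x y hw hP
  exact h5.symm

/-- Horizontal connections along the line of height `12 m`, through vertices above (`s = 1`) or
below (`s = -1`) that line. -/
lemma joined_row (m s : ℤ) (hs : s = 1 ∨ s = -1)
    (hP : ∀ x y, y = 12 * m ∨ y = 12 * m + 3 * s → P x y) (n : ℤ) :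
    Joined P (12 * n + 3) (12 * m) 3 (12 * m) ∧
      Joined P (12 * n + 9) (12 * m) 3 (12 * m) := by
  have A : ∀ n, Joined P (12 * n + 9) (12 * m) (12 * n + 3) (12 * m) := fun n =>
    ((Corner.joined (x := 12 * n + 6 - 3 * s) (y := 12 * m + 3 * s) (12 * n + 6) (12 * m)
      (by unfold Corner; omega) (hP _ _ (by omega)) (hP _ _ (by omega))).symm.trans
      (Corner.joined (12 * n + 6) (12 * m) (by unfold Corner; omega) (hP _ _ (by omega))
        (hP _ _ (by omega))))
  have B : ∀ n, Joined P (12 * (n + 1) + 3) (12 * m) (12 * n + 9) (12 * m) := fun n =>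
    ((Corner.joined (x' := 12 * n + 12) (y' := 12 * m + 3 * s) (12 * n + 12) (12 * m)
      (by unfold Corner; omega) (hP _ _ (by omega)) (hP _ _ (by omega))).trans
      (Corner.joined (12 * n + 12) (12 * m) (by unfold Corner; omega) (hP _ _ (by omega))
        (hP _ _ (by omega))).symm)
  have C : Joined P (12 * n + 3) (12 * m) 3 (12 * m) := by
    induction n using Int.induction_on with
    -- `Joined` includes membership of its endpoints, so reflexivity is obtained by a step to a
    -- neighbour and back.
    | zero => exact (A 0).symm.trans (A 0)
    | succ i ih => exact (B i).trans ((A i).trans ih)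
    | pred i ih =>
      have b := B (-i - 1)
      rw [sub_add_cancel] at b
      exact (A _).symm.trans (b.symm.trans ih)
  exact ⟨C, (A n).trans C⟩

/-- The connection between the lines of heights `12 m` and `12 (m + 1)`. -/
lemma joined_rows (m : ℤ) (hP : ∀ x y, 12 * m ≤ y → y ≤ 12 * m + 12 → P x y) :
    Joined P 3 (12 * m) 3 (12 * (m + 1)) :=
  (Corner.joined (x' := 0) (y' := 12 * m + 3) 0 (12 * m) (by unfold Corner; omega)
    (hP _ _ (by omega) (by omega)) (hP _ _ (by omega) (by omega))).trans <|
  (Corner.joined (x' := -3) (y' := 12 * m + 9) 0 (12 * m + 6) (by unfold Corner; omega)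
    (hP _ _ (by omega) (by omega)) (hP _ _ (by omega) (by omega))).trans <|
  (Corner.joined (x := 0) (y := 12 * m + 9) 0 (12 * m + 6) (by unfold Corner; omega)
    (hP _ _ (by omega) (by omega)) (hP _ _ (by omega) (by omega))).symm.trans <|
  (Corner.joined 0 (12 * m + 12) (by unfold Corner; omega)
    (hP _ _ (by omega) (by omega)) (hP _ _ (by omega) (by omega))).symm

lemma joined_upper_row (m : ℤ) (hm : 1 ≤ m) (n : ℤ) :
    Joined Upper (12 * n + 3) (12 * m) 3 12 ∧ Joined Upper (12 * n + 9) (12 * m) 3 12 := by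
  have h : Joined Upper 3 (12 * m) 3 12 := by
    induction m, hm using Int.leInduction with
    | base =>
      have := joined_rows (P := Upper) 1 fun x y _ _ => by unfold Upper; omega
      exact this.trans this.symm
    | succ m hm ih => exact (joined_rows m fun x y _ _ => by unfold Upper; omega).symm.trans ih
  have r := joined_row (P := Upper) m 1 (Or.inl rfl) (fun x y _ => by unfold Upper; omega) n
  exact ⟨r.1.trans h, r.2.trans h⟩

lemma joined_lower_row (m : ℤ) (hm : m ≤ -1) (n : ℤ) :
    Joined (fun x y => ¬ Upper x y) (12 * n + 3) (12 * m) 3 (-12) ∧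
      Joined (fun x y => ¬ Upper x y) (12 * n + 9) (12 * m) 3 (-12) := by
  have h : Joined (fun x y => ¬ Upper x y) 3 (12 * m) 3 (-12) := by
    induction m, hm using Int.leInductionDown with
    | base =>
      have := joined_rows (P := fun x y => ¬ Upper x y) (-2)
        fun x y _ _ => by unfold Upper; omega
      exact this.symm.trans this
    | pred m hm ih =>
      have := joined_rows (P := fun x y => ¬ Upper x y) (m - 1)
        fun x y _ _ => by unfold Upper; omega
      rw [sub_add_cancel] at this
      exact this.trans ih
  have r := joined_row (P := fun x y => ¬ Upper x y) m (-1) (Or.inr rfl)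
    (fun x y _ => by unfold Upper; omega) n
  exact ⟨r.1.trans h, r.2.trans h⟩

/-- The rows of height at least `12` are already joined. Any other vertex of height at least `9` is
one edge away from such a row, and the remaining vertices, of height `0` or `3` to the right of the
turn, climb to height `9` in at most two edges. -/
lemma joined_upper (hw : (x, y) ∈ rubySet) (hP : Upper x y) : Joined Upper x y 3 12 := by
  have hr : ∀ a b, a % 12 = 3 ∨ a % 12 = 9 → b % 12 = 0 → 12 ≤ b → Joined Upper a b 3 12 := by
    intro a b ha hb hb'
    have := joined_upper_row (b / 12) (by omega) (a / 12)
    rcases ha with ha | ha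
    · convert this.1 using 1 <;> omega
    · convert this.2 using 1 <;> omega
  have h9 : ∀ a b, (a, b) ∈ rubySet → 9 ≤ b → Joined Upper a b 3 12 := by
    intro a b hab hb
    rcases mem_rubySet.1 hab with c | c | c | c | c | c <;> simp only at c
    · exact hr a b (by omega) (by omega) (by omega)
    · exact hr a b (by omega) (by omega) (by omega)
    · exact (Corner.joined (x := a + 3) (y := b - 3) a (b - 3) (by unfold Corner; omega)
        (by unfold Upper; omega) (by unfold Upper; omega)).symm.trans
        (hr _ _ (by omega) (by omega) (by omega))
    · exact (Corner.joined (x := a + 3) (y := b + 3) a (b + 3) (by unfold Corner; omega)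
        (by unfold Upper; omega) (by unfold Upper; omega)).symm.trans
        (hr _ _ (by omega) (by omega) (by omega))
    · exact (Corner.joined (x' := a) (y' := b + 3) (a - 3) (b + 3) (by unfold Corner; omega)
        (by unfold Upper; omega) (by unfold Upper; omega)).trans
        (hr _ _ (by omega) (by omega) (by omega))
    · exact (Corner.joined (x' := a) (y' := b - 3) (a + 3) (b - 3) (by unfold Corner; omega)
        (by unfold Upper; omega) (by unfold Upper; omega)).trans
        (hr _ _ (by omega) (by omega) (by omega))
  have h3 : ∀ a, a % 12 = 3 → 0 < a → Joined Upper a 3 3 12 := fun a ha ha' =>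
    (Corner.joined (x := a - 3) (y := 9) (a - 3) 6 (by unfold Corner; omega)
      (by unfold Upper; omega) (by unfold Upper; omega)).symm.trans
      (h9 _ _ (by rw [mem_rubySet]; simp only; omega) (by omega))
  by_cases hy : 9 ≤ y
  · exact h9 x y hw hy
  rcases mem_rubySet.1 hw with c | c | c | c | c | c <;> simp only at c <;> unfold Upper at hP
  · omega
  · obtain rfl : y = 0 := by omega
    exact (Corner.joined (x := x - 6) (y := 3) (x - 3) 0 (by unfold Corner; omega)
      (by unfold Upper; omega) (by unfold Upper; omega)).symm.trans
      (h3 _ (by omega) (by omega))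
  · obtain rfl : y = 3 := by omega
    exact (Corner.joined (x' := x - 3) (y' := 9) x 6 (by unfold Corner; omega)
      (by unfold Upper; omega) (by unfold Upper; omega)).trans
      (h9 _ _ (by rw [mem_rubySet]; simp only; omega) (by omega))
  · omega
  · omega
  · obtain rfl : y = 3 := by omega
    exact h3 x (by omega) (by omega)

/-- As for the upper side, now with rows of height at most `-12`. The vertices near the path descend
through height `0` (when they start at `3`) and through `(12 k, -3)` to height `-9`. -/
lemma joined_lower (hw : (x, y) ∈ rubySet) (hP : ¬ Upper x y) :
    Joined (fun x y => ¬ Upper x y) x y 3 (-12) := by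
  have hr : ∀ a b, a % 12 = 3 ∨ a % 12 = 9 → b % 12 = 0 → b ≤ -12 →
      Joined (fun x y => ¬ Upper x y) a b 3 (-12) := by
    intro a b ha hb hb'
    have := joined_lower_row (b / 12) (by omega) (a / 12)
    rcases ha with ha | ha
    · convert this.1 using 1 <;> omega
    · convert this.2 using 1 <;> omega
  have h9 : ∀ a b, (a, b) ∈ rubySet → b ≤ -9 →
      Joined (fun x y => ¬ Upper x y) a b 3 (-12) := by
    intro a b hab hb
    rcases mem_rubySet.1 hab with c | c | c | c | c | c <;> simp only at c
    · exact hr a b (by omega) (by omega) (by omega)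
    · exact hr a b (by omega) (by omega) (by omega)
    · exact (Corner.joined (x := a + 3) (y := b - 3) a (b - 3) (by unfold Corner; omega)
        (by unfold Upper; omega) (by unfold Upper; omega)).symm.trans
        (hr _ _ (by omega) (by omega) (by omega))
    · exact (Corner.joined (x := a + 3) (y := b + 3) a (b + 3) (by unfold Corner; omega)
        (by unfold Upper; omega) (by unfold Upper; omega)).symm.trans
        (hr _ _ (by omega) (by omega) (by omega))
    · exact (Corner.joined (x' := a) (y' := b + 3) (a - 3) (b + 3) (by unfold Corner; omega)
        (by unfold Upper; omega) (by unfold Upper; omega)).trans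
        (hr _ _ (by omega) (by omega) (by omega))
    · exact (Corner.joined (x' := a) (y' := b - 3) (a + 3) (b - 3) (by unfold Corner; omega)
        (by unfold Upper; omega) (by unfold Upper; omega)).trans
        (hr _ _ (by omega) (by omega) (by omega))
  have h3 : ∀ a, a % 12 = 0 → Joined (fun x y => ¬ Upper x y) a (-3) 3 (-12) := fun a ha =>
    (Corner.joined (x' := a + 3) (y' := -9) a (-6) (by unfold Corner; omega)
      (by unfold Upper; omega) (by unfold Upper; omega)).trans
      (h9 _ _ (by rw [mem_rubySet]; simp only; omega) (by omega))
  have h0 : ∀ a, a % 12 = 3 ∨ a % 12 = 9 ∧ a ≤ 0 →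
      Joined (fun x y => ¬ Upper x y) a 0 3 (-12) := by
    rintro a (ha | ha)
    · exact (Corner.joined (x' := a - 3) (y' := -3) (a - 3) 0 (by unfold Corner; omega)
        (by unfold Upper; omega) (by unfold Upper; omega)).trans (h3 _ (by omega))
    · exact (Corner.joined (x' := a + 3) (y' := -3) (a + 3) 0 (by unfold Corner; omega)
        (by unfold Upper; omega) (by unfold Upper; omega)).trans (h3 _ (by omega))
  by_cases hy : y ≤ -9
  · exact h9 x y hw hy
  rcases mem_rubySet.1 hw with c | c | c | c | c | c <;> simp only at c <;> unfold Upper at hP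
  · obtain rfl : y = 0 := by omega
    exact h0 x (by omega)
  · obtain rfl : y = 0 := by omega
    exact h0 x (by omega)
  · obtain rfl : y = 3 := by omega
    exact (Corner.joined (x := x + 3) (y := 0) x 0 (by unfold Corner; omega)
      (by unfold Upper; omega) (by unfold Upper; omega)).symm.trans
      (h0 _ (by omega))
  · obtain rfl : y = -3 := by omega
    exact h3 x (by omega)
  · obtain rfl : y = -3 := by omega
    exact (Corner.joined (x := x + 3) (y := -9) (x + 3) (-6) (by unfold Corner; omega)
      (by unfold Upper; omega) (by unfold Upper; omega)).symm.trans
      (h9 _ _ (by rw [mem_rubySet]; simp only; omega) (by omega))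
  · obtain rfl : y = 3 := by omega
    exact (Corner.joined (x' := x) (y' := 0) (x + 3) 0 (by unfold Corner; omega)
      (by unfold Upper; omega) (by unfold Upper; omega)).trans
      (h0 _ (by omega))

lemma connected_upper : (rubyGraph.induce (region Upper)).Connected :=
  connected_of_joined 3 12 (by rw [mem_rubySet]; simp) (by unfold Upper; omega)
    fun _ _ => joined_upper

lemma connected_lower : (rubyGraph.induce (region Upper)ᶜ).Connected :=
  connected_of_joined (P := fun x y => ¬ Upper x y) 3 (-12) (by rw [mem_rubySet]; simp)
    (by unfold Upper; omega) fun _ _ => joined_lower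

lemma infinite_upper : (region Upper).Infinite := by
  refine Set.infinite_of_injective_forall_mem (f := fun n : ℕ =>
    (⟨(3, 12 * (n + 1)), by rw [mem_rubySet]; simp⟩ : Ruby)) (fun n m h => ?_) fun n => ?_
  · have := congrArg (fun w : Ruby => w.1.2) h
    simp at this
    omega
  · simp [region, Upper]
    omega

lemma infinite_lower : (region Upper)ᶜ.Infinite := by
  refine Set.infinite_of_injective_forall_mem (f := fun n : ℕ =>
    (⟨(3, -12 * (n + 1)), by rw [mem_rubySet]; simp⟩ : Ruby)) (fun n m h => ?_) fun n => ?_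
  · have := congrArg (fun w : Ruby => w.1.2) h
    simp at this
    omega
  · simp [region, Upper]
    omega

end

/-! ## The path -/

/-- The path which comes in through the hexagons on the line of height `6`, turns at the Kagome
vertex `(0, 6)` and leaves through the triangles around the line of height `0`. -/
def pathPoint (t : ℤ) : ℤ × ℤ :=
  if t ≤ 0 then (6 * t, 6) else if t % 4 = 1 then (3 * t - 1, 2) else
  if t % 4 = 3 then (3 * t + 1, -2) else (3 * t, 0)

lemma pathPoint_eq_iff (t a b : ℤ) : pathPoint t = (a, b) ↔
    (t ≤ 0 ∧ a = 6 * t ∧ b = 6) ∨ (0 < t ∧ t % 4 = 1 ∧ a = 3 * t - 1 ∧ b = 2) ∨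
    (0 < t ∧ t % 4 = 3 ∧ a = 3 * t + 1 ∧ b = -2) ∨ (0 < t ∧ t % 2 = 0 ∧ a = 3 * t ∧ b = 0) := by
  unfold pathPoint
  split_ifs <;> rw [Prod.mk.injEq] <;> omega

lemma pathPoint_cases (t : ℤ) :
    (t ≤ 0 ∧ (pathPoint t).1 = 6 * t ∧ (pathPoint t).2 = 6) ∨
    (0 < t ∧ t % 4 = 1 ∧ (pathPoint t).1 = 3 * t - 1 ∧ (pathPoint t).2 = 2) ∨
    (0 < t ∧ t % 4 = 3 ∧ (pathPoint t).1 = 3 * t + 1 ∧ (pathPoint t).2 = -2) ∨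
    (0 < t ∧ t % 2 = 0 ∧ (pathPoint t).1 = 3 * t ∧ (pathPoint t).2 = 0) :=
  (pathPoint_eq_iff t _ _).1 rfl

lemma pathPoint_injective : Function.Injective pathPoint := by
  intro s t h
  have hs := pathPoint_cases s
  have ht := pathPoint_cases t
  rw [h] at hs
  omega

lemma pathPoint_mem (t : ℤ) : pathPoint t ∈ dualVertices := by
  have hex : ∀ a b : ℤ, a % 12 = 6 → b % 12 = 6 → (a, b) ∈ dualVertices := fun a b ha hb =>
    Or.inl (Or.inr ⟨(a - 6, b - 6), mem_kagome₁.2 (by simp only; omega), by simp⟩)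
  have tri : ∀ a b : ℤ, a % 12 = 2 ∧ b % 12 = 2 ∨ a % 12 = 10 ∧ b % 12 = 10 →
      (a, b) ∈ dualVertices := by
    rintro a b (h | h)
    · exact Or.inr ⟨(a - 2, b - 2), mem_kagome₁.2 (by simp only; omega), Or.inl (by simp)⟩
    · exact Or.inr ⟨(a + 2, b + 2), mem_kagome₁.2 (by simp only; omega), Or.inr (by simp)⟩
  have kag : ∀ a b : ℤ, (a % 12 = 0 ∧ b % 12 = 0 ∨ a % 12 = 6 ∧ b % 12 = 0 ∨
      a % 12 = 0 ∧ b % 12 = 6) → (a, b) ∈ dualVertices := fun a b h =>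
    Or.inl (Or.inl (kagome_mem h))
  unfold pathPoint
  split_ifs with h1 h2 h3
  · by_cases h : t % 2 = 0
    · exact kag _ _ (by omega)
    · exact hex _ _ (by omega) (by omega)
  · exact tri _ _ (by omega)
  · exact tri _ _ (by omega)
  · exact kag _ _ (by omega)

/-- `(u, v)`, `(u', v')` and `(p, q)` are the positions, relative to the Kagome vertex `(a, b)`, of
an incoming vertex, an outgoing vertex, and of the second face adjacent to the edge from the
one to the other. -/
def EdgeShape (a b u v u' v' p q : ℤ) : Prop :=
  (a % 12 = 0 ∧ b % 12 = 0 ∧ v = 0 ∧ u' = 0 ∧ (u = 3 ∨ u = -3) ∧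
    (v' = -u ∧ p = 2 * u ∧ q = 2 * v' ∨ v' = u ∧ 3 * p = 2 * u ∧ 3 * q = 2 * v')) ∨
  (a % 12 = 6 ∧ b % 12 = 0 ∧ v = -u ∧ v' = 0 ∧ (u = 3 ∨ u = -3) ∧
    (u' = -u ∧ p = 0 ∧ q = 2 * v ∨ u' = u ∧ 3 * p = 4 * u ∧ 3 * q = 2 * v)) ∨
  (a % 12 = 0 ∧ b % 12 = 6 ∧ u = 0 ∧ v' = -u' ∧ (v = 3 ∨ v = -3) ∧
    (u' = v ∧ p = 2 * v ∧ q = 0 ∨ u' = -v ∧ 3 * p = 2 * u' ∧ 3 * q = 4 * v))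

lemma edgeShape (z : Kagome) (i j : Fin 2) :
    ∃ u v u' v' p q : ℤ, (inVertex z j).1 = (z.1.1 + u, z.1.2 + v) ∧
      (outVertex z i).1 = (z.1.1 + u', z.1.2 + v') ∧
      otherFace z i j = (z.1.1 + p, z.1.2 + q) ∧ EdgeShape z.1.1 z.1.2 u v u' v' p q := by
  refine ⟨3 * sgn j * (inDir z.1).1, 3 * sgn j * (inDir z.1).2, 3 * sgn i * (outDir z.1).1,
    3 * sgn i * (outDir z.1).2, (if i = j then (6 : ℤ) else 2) *
      (sgn j * (inDir z.1).1 + sgn i * (outDir z.1).1), (if i = j then (6 : ℤ) else 2) *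
      (sgn j * (inDir z.1).2 + sgn i * (outDir z.1).2), ?_, ?_, ?_, ?_⟩
  · exact Prod.ext (by simp [inVertex]) (by simp [inVertex])
  · exact Prod.ext (by simp [outVertex]) (by simp [outVertex])
  · exact Prod.ext (by simp only [otherFace, Prod.fst_add, Prod.smul_fst, smul_eq_mul])
      (by simp only [otherFace, Prod.snd_add, Prod.smul_snd, smul_eq_mul])
  · unfold EdgeShape
    rcases kagome_cases z with ⟨h1, h2, h3, h4⟩ | ⟨h1, h2, h3, h4⟩ | ⟨h1, h2, h3, h4⟩ <;>
      rw [h3, h4] <;> fin_cases i <;> fin_cases j <;> simp [sgn, h1, h2]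

/-- A directed edge determines its Kagome vertex and both indices, because `inVertex` and
`outVertex` are injective in all their arguments. -/
lemma bisects_iff (f g : ℤ × ℤ) (z : Kagome) (i j : Fin 2) :
    Bisects f g (inVertex z j) (outVertex z i) ↔
      (f = z.1 ∧ g = otherFace z i j) ∨ (g = z.1 ∧ f = otherFace z i j) := by
  refine ⟨?_, fun h => ⟨z, i, j, rfl, rfl, h⟩⟩
  rintro ⟨z', i', j', h1, h2, h⟩
  have e1 := @inVertex_injective (z, j) (z', j') h1
  have e2 := @outVertex_injective (z, i) (z', i') h2
  simp only [Prod.mk.injEq] at e1 e2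
  obtain ⟨rfl, rfl⟩ := e1
  obtain ⟨-, rfl⟩ := e2
  exact h

lemma pathPoint_link (t : ℤ) : ∃ x y, Bisects (pathPoint t) (pathPoint (t + 1)) x y := by
  have key : ∃ (a b : ℤ) (i j : Fin 2) (h : (a, b) ∈ kagomeSet),
      (pathPoint t = (a, b) ∧ pathPoint (t + 1) = otherFace ⟨(a, b), h⟩ i j) ∨
      (pathPoint (t + 1) = (a, b) ∧ pathPoint t = otherFace ⟨(a, b), h⟩ i j) := by
    -- `build` trades `otherFace` for an explicit offset `(p, q)`, which leaves linear arithmetic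
    -- modulo `12` for each type of link.
    have build : ∀ (a b : ℤ) (i j : Fin 2) (p q : ℤ)
        (_ : a % 12 = 0 ∧ b % 12 = 0 ∧ p = (if i = j then 6 else 2) * sgn j ∧
            q = (if i = j then 6 else 2) * -sgn i ∨
          a % 12 = 6 ∧ b % 12 = 0 ∧ p = (if i = j then 6 else 2) * (sgn j - sgn i) ∧
            q = (if i = j then 6 else 2) * -sgn j ∨
          a % 12 = 0 ∧ b % 12 = 6 ∧ p = (if i = j then 6 else 2) * sgn i ∧
            q = (if i = j then 6 else 2) * (sgn j - sgn i))
        (_ : (pathPoint t = (a, b) ∧ pathPoint (t + 1) = (a + p, b + q)) ∨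
          (pathPoint (t + 1) = (a, b) ∧ pathPoint t = (a + p, b + q))),
        ∃ (a b : ℤ) (i j : Fin 2) (h : (a, b) ∈ kagomeSet),
          (pathPoint t = (a, b) ∧ pathPoint (t + 1) = otherFace ⟨(a, b), h⟩ i j) ∨
          (pathPoint (t + 1) = (a, b) ∧ pathPoint t = otherFace ⟨(a, b), h⟩ i j) := by
      intro a b i j p q h h'
      have hz : (a, b) ∈ kagomeSet := kagome_mem (by omega)
      refine ⟨a, b, i, j, hz, ?_⟩
      have : otherFace ⟨(a, b), hz⟩ i j = (a + p, b + q) := by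
        unfold otherFace
        rcases kagome_cases ⟨(a, b), hz⟩ with c | c | c <;> simp only at c <;>
          obtain ⟨c1, c2, c3, c4⟩ := c <;> rw [c3, c4] <;> simp [c1, c2] at h <;>
          rw [h.1, h.2] <;> ext <;> simp <;> split_ifs <;> ring
      rwa [this]
    rcases le_or_gt t (-1) with ht | ht
    · by_cases h2 : t % 2 = 0
      · refine build (6 * t) 6 0 0 6 0 (by simp [sgn]; omega) (Or.inl ?_)
        simp only [pathPoint_eq_iff, and_true]; omega
      · refine build (6 * t + 6) 6 1 1 (-6) 0 (by simp [sgn]; omega) (Or.inr ?_)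
        simp only [pathPoint_eq_iff, and_true]; omega
    rcases (by omega : t = 0 ∨ 0 < t) with rfl | ht
    · refine build 0 6 0 1 2 (-4) (by simp [sgn]) (Or.inl ?_)
      simp only [pathPoint_eq_iff, and_true]; omega
    rcases (by omega : t % 4 = 0 ∨ t % 4 = 1 ∨ t % 4 = 2 ∨ t % 4 = 3) with h | h | h | h
    · refine build (3 * t) 0 1 0 2 2 (by simp [sgn]; omega) (Or.inl ?_)
      simp only [pathPoint_eq_iff, and_true]; omega
    · refine build (3 * t + 3) 0 0 1 (-4) 2 (by simp [sgn]; omega) (Or.inr ?_)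
      simp only [pathPoint_eq_iff, and_true]; omega
    · refine build (3 * t) 0 1 0 4 (-2) (by simp [sgn]; omega) (Or.inl ?_)
      simp only [pathPoint_eq_iff, and_true]; omega
    · refine build (3 * t + 3) 0 0 1 (-2) (-2) (by simp [sgn]; omega) (Or.inr ?_)
      simp only [pathPoint_eq_iff, and_true]; omega
  obtain ⟨a, b, i, j, h, h'⟩ := key
  exact ⟨_, _, ⟨(a, b), h⟩, i, j, rfl, rfl, h'⟩

/-- Supplies the orientation condition of admissibility and one half of the boundary condition: an
edge crossed by the path has its endpoints on different sides. -/
lemma leftOf_pathPoint_iff {a b u v u' v' p q t : ℤ} (h : EdgeShape a b u v u' v' p q)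
    (ht : (pathPoint t = (a, b) ∧ pathPoint (t + 1) = (a + p, b + q)) ∨
      (pathPoint (t + 1) = (a, b) ∧ pathPoint t = (a + p, b + q))) :
    (LeftOf (pathPoint t) (pathPoint (t + 1)) (a + u, b + v) ↔ Upper (a + u) (b + v)) ∧
    (LeftOf (pathPoint t) (pathPoint (t + 1)) (a + u', b + v') ↔ Upper (a + u') (b + v')) ∧
    ¬ (Upper (a + u) (b + v) ↔ Upper (a + u') (b + v')) := by
  -- `LeftOf` is quadratic in the unknowns; once the direction of the link is a pair of numerals it
  -- is linear and within reach of `omega`.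
  have hd : ∀ f g x : ℤ × ℤ, ∀ d e : ℤ, g.1 - f.1 = d → g.2 - f.2 = e →
      (LeftOf f g x ↔ 0 < d * (x.2 - f.2) - e * (x.1 - f.1)) := by
    rintro f g x d e rfl rfl
    rfl
  have h0 := pathPoint_cases t
  have h1 := pathPoint_cases (t + 1)
  have hx : ((pathPoint t).1 = a ∧ (pathPoint t).2 = b ∧ (pathPoint (t + 1)).1 = a + p ∧
      (pathPoint (t + 1)).2 = b + q) ∨ ((pathPoint (t + 1)).1 = a ∧ (pathPoint (t + 1)).2 = b ∧
      (pathPoint t).1 = a + p ∧ (pathPoint t).2 = b + q) := by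
    rcases ht with ⟨e1, e2⟩ | ⟨e1, e2⟩ <;> simp [e1, e2]
  clear ht
  generalize pathPoint t = f at *
  generalize pathPoint (t + 1) = g at *
  -- Of the twelve edge shapes, five are never crossed by the path. The other seven are the four
  -- links of one period along the triangles, the two along the hexagons, and the link leaving the
  -- turn.
  rcases h with ⟨h2, h3, rfl, rfl, rfl | rfl, ⟨rfl, rfl, rfl⟩ | ⟨rfl, hp, hq⟩⟩ |
    ⟨h2, h3, rfl, rfl, rfl | rfl, ⟨rfl, rfl, rfl⟩ | ⟨rfl, hp, hq⟩⟩ |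
    ⟨h2, h3, rfl, rfl, rfl | rfl, ⟨rfl, rfl, rfl⟩ | ⟨rfl, hp, hq⟩⟩
  · omega
  · have m : b = 0 ∧ 0 < a ∧ f.1 = a ∧ f.2 = b ∧ g.1 - f.1 = 2 ∧ g.2 - f.2 = 2 := by
      omega
    clear h0 h1 hx
    rw [hd f g _ 2 2 (by omega) (by omega), hd f g _ 2 2 (by omega) (by omega)]
    unfold Upper
    simp only
    omega
  · omega
  · have m : b = 0 ∧ 0 < a ∧ f.1 = a - 2 ∧ f.2 = b - 2 ∧ g.1 - f.1 = 2 ∧ g.2 - f.2 = 2 := by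
      omega
    clear h0 h1 hx
    rw [hd f g _ 2 2 (by omega) (by omega), hd f g _ 2 2 (by omega) (by omega)]
    unfold Upper
    simp only
    omega
  · omega
  · have m : b = 0 ∧ 0 < a ∧ f.1 = a ∧ f.2 = b ∧ g.1 - f.1 = 4 ∧ g.2 - f.2 = -2 := by
      omega
    clear h0 h1 hx
    rw [hd f g _ 4 (-2) (by omega) (by omega), hd f g _ 4 (-2) (by omega) (by omega)]
    unfold Upper
    simp only
    omega
  · omega
  · have m : b = 0 ∧ 0 < a ∧ f.1 = a - 4 ∧ f.2 = b + 2 ∧ g.1 - f.1 = 4 ∧ g.2 - f.2 = -2 := by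
      omega
    clear h0 h1 hx
    rw [hd f g _ 4 (-2) (by omega) (by omega), hd f g _ 4 (-2) (by omega) (by omega)]
    unfold Upper
    simp only
    omega
  · have m : b = 6 ∧ a < 0 ∧ f.1 = a ∧ f.2 = b ∧ g.1 - f.1 = 6 ∧ g.2 - f.2 = 0 := by
      omega
    clear h0 h1 hx
    rw [hd f g _ 6 0 (by omega) (by omega), hd f g _ 6 0 (by omega) (by omega)]
    unfold Upper
    simp only
    omega
  · omega
  · have m : b = 6 ∧ a ≤ 0 ∧ f.1 = a - 6 ∧ f.2 = b ∧ g.1 - f.1 = 6 ∧ g.2 - f.2 = 0 := by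
      omega
    clear h0 h1 hx
    rw [hd f g _ 6 0 (by omega) (by omega), hd f g _ 6 0 (by omega) (by omega)]
    unfold Upper
    simp only
    omega
  · have m : b = 6 ∧ a = 0 ∧ f.1 = a ∧ f.2 = b ∧ g.1 - f.1 = 2 ∧ g.2 - f.2 = -4 := by
      omega
    clear h0 h1 hx
    rw [hd f g _ 2 (-4) (by omega) (by omega), hd f g _ 2 (-4) (by omega) (by omega)]
    unfold Upper
    simp only
    omega

/-- The other half of the boundary condition. In the five shapes never crossed, both endpoints are
on the same side, contradicting `hu`. -/
lemma exists_pathPoint {a b u v u' v' p q : ℤ} (h : EdgeShape a b u v u' v' p q)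
    (hu : ¬ (Upper (a + u) (b + v) ↔ Upper (a + u') (b + v'))) :
    ∃ t, (pathPoint t = (a, b) ∧ pathPoint (t + 1) = (a + p, b + q)) ∨
      (pathPoint (t + 1) = (a, b) ∧ pathPoint t = (a + p, b + q)) := by
  have inl : ∀ t, pathPoint t = (a, b) → pathPoint (t + 1) = (a + p, b + q) →
      ∃ t, (pathPoint t = (a, b) ∧ pathPoint (t + 1) = (a + p, b + q)) ∨
        (pathPoint (t + 1) = (a, b) ∧ pathPoint t = (a + p, b + q)) :=
    fun t h h' => ⟨t, Or.inl ⟨h, h'⟩⟩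
  have inr : ∀ t, pathPoint (t + 1) = (a, b) → pathPoint t = (a + p, b + q) →
      ∃ t, (pathPoint t = (a, b) ∧ pathPoint (t + 1) = (a + p, b + q)) ∨
        (pathPoint (t + 1) = (a, b) ∧ pathPoint t = (a + p, b + q)) :=
    fun t h h' => ⟨t, Or.inr ⟨h, h'⟩⟩
  simp only [pathPoint_eq_iff] at inl inr ⊢
  unfold Upper at hu
  rcases h with ⟨h1, h2, rfl, rfl, rfl | rfl, ⟨rfl, rfl, rfl⟩ | ⟨rfl, hp, hq⟩⟩ |
    ⟨h1, h2, rfl, rfl, rfl | rfl, ⟨rfl, rfl, rfl⟩ | ⟨rfl, hp, hq⟩⟩ |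
    ⟨h1, h2, rfl, rfl, rfl | rfl, ⟨rfl, rfl, rfl⟩ | ⟨rfl, hp, hq⟩⟩
  · omega
  · have : b = 0 ∧ 0 < a := by omega
    -- The path visits Kagome vertices at even times, `(3 t, 0)` after the turn and `(6 t, 6)` up to
    -- it. So the time is `a / 3` or `a / 6`, lowered by one when the link arrives at `(a, b)`
    -- instead of leaving it.
    exact inl (a / 3) (by omega) (by omega)
  · omega
  · have : b = 0 ∧ 0 < a := by omega
    exact inr (a / 3 - 1) (by omega) (by omega)
  · omega
  · have : b = 0 ∧ 0 < a := by omega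
    exact inl (a / 3) (by omega) (by omega)
  · omega
  · have : b = 0 ∧ 0 < a := by omega
    exact inr (a / 3 - 1) (by omega) (by omega)
  · have : b = 6 ∧ a < 0 := by omega
    exact inl (a / 6) (by omega) (by omega)
  · omega
  · have : b = 6 ∧ a ≤ 0 := by omega
    exact inr (a / 6 - 1) (by omega) (by omega)
  · have : b = 6 ∧ a = 0 := by omega
    exact inl 0 (by omega) (by omega)

lemma isAdmissible_pathPoint : IsAdmissible pathPoint (region Upper) where
  infinite := infinite_upper
  infinite_compl := infinite_lower
  connected := connected_upper
  connected_compl := connected_lower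
  injective := pathPoint_injective
  mem_dual := pathPoint_mem
  link := pathPoint_link
  boundary := by
    rintro _ _ ⟨z, i, j, rfl, rfl⟩
    obtain ⟨u, v, u', v', p, q, h1, h2, h3, h⟩ := edgeShape z i j
    simp only [bisects_iff, h3]
    change _ ↔ ¬ (Upper _ _ ↔ Upper _ _)
    rw [h1, h2]
    exact ⟨fun ⟨t, ht⟩ => (leftOf_pathPoint_iff h ht).2.2, exists_pathPoint h⟩
  left := by
    rintro t _ _ ⟨z, i, j, rfl, rfl, ht⟩
    obtain ⟨u, v, u', v', p, q, h1, h2, h3, h⟩ := edgeShape z i j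
    rw [h3] at ht
    change (_ ↔ Upper _ _) ∧ (_ ↔ Upper _ _)
    rw [h1, h2]
    have := leftOf_pathPoint_iff h ht
    exact ⟨this.1, this.2.1⟩

/-! ## The flux through the half space -/

lemma sum_sq_norm_row (s : Matrix.unitaryGroup (Fin 2) ℂ) (i : Fin 2) :
    ‖s.1 i 0‖ ^ 2 + ‖s.1 i 1‖ ^ 2 = 1 := by
  have hS := congrFun (congrFun (Matrix.mem_unitaryGroup_iff.1 s.2) i) i
  simp only [Matrix.mul_apply, Matrix.star_apply, Fin.sum_univ_two, Matrix.one_apply_eq] at hS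
  rw [← Complex.ofReal_inj]
  push_cast
  rw [← Complex.mul_conj', ← Complex.mul_conj']
  exact hS

lemma sum_sq_norm_col (s : Matrix.unitaryGroup (Fin 2) ℂ) (j : Fin 2) :
    ‖s.1 0 j‖ ^ 2 + ‖s.1 1 j‖ ^ 2 = 1 := by
  have hS := congrFun (congrFun (Matrix.mem_unitaryGroup_iff'.1 s.2) j) j
  simp only [Matrix.mul_apply, Matrix.star_apply, Fin.sum_univ_two, Matrix.one_apply_eq] at hS
  rw [← Complex.ofReal_inj]
  push_cast
  rw [← Complex.conj_mul', ← Complex.conj_mul']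
  exact hS

lemma rAbs_eq (S : ScatteringMatrices) (z : Kagome) : rAbs S z = ‖(S z).1 0 0‖ := by
  have h : inEquiv.symm (inVertex z 0) = (z, 0) := inEquiv.symm_apply_apply (z, 0)
  have e : evolution S (ket (inVertex z 0)) = column S (inVertex z 0) := by
    rw [evolution_ket, column, h]
  classical
  rw [rAbs, weight, inner_ket, e, column_apply, if_pos rfl]

/-- Rows and columns of a unitary 2×2 matrix have norm one, so a single modulus determines the other
three. -/
lemma sq_norm_eq (S : ScatteringMatrices) (z : Kagome) (i j : Fin 2) :
    ‖(S z).1 i j‖ ^ 2 = if i = j then rAbs S z ^ 2 else 1 - rAbs S z ^ 2 := by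
  rw [rAbs_eq]
  have := sum_sq_norm_row (S z) 0
  have := sum_sq_norm_col (S z) 0
  have := sum_sq_norm_col (S z) 1
  revert i j
  simp only [Fin.forall_fin_two, Fin.isValue, reduceIte, zero_ne_one, one_ne_zero]
  refine ⟨⟨?_, ?_⟩, ?_, ?_⟩ <;> first | trivial | linarith

/-- The Kagome vertex where the path turns from the hexagons to the triangles. -/
def turn : Kagome := ⟨(0, 6), kagome_mem (by omega)⟩

/-- Away from the turn, the path leaves each rectangle it visits through the edge opposite to its
entry, so it separates two edges, each with one incoming and one outgoing corner. -/
lemma region_upper_balanced (z : Kagome) (hz : z ≠ turn) :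
    (∃ p : Prop, (∀ k, outVertex z k ∈ region Upper ↔ p) ∧
      ∀ k, inVertex z k ∈ region Upper ↔ p) ∨
    ∃ i j : Fin 2, (∀ k, outVertex z k ∈ region Upper ↔ k = i) ∧
      ∀ k, inVertex z k ∈ region Upper ↔ k = j := by
  have hz' : ¬ (z.1.1 = 0 ∧ z.1.2 = 6) := fun h => hz (Subtype.ext (Prod.ext h.1 h.2))
  have hi : ∀ k, inVertex z k ∈ region Upper ↔
      Upper (z.1.1 + 3 * sgn k * (inDir z.1).1) (z.1.2 + 3 * sgn k * (inDir z.1).2) :=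
    fun k => Iff.rfl
  have ho : ∀ k, outVertex z k ∈ region Upper ↔
      Upper (z.1.1 + 3 * sgn k * (outDir z.1).1) (z.1.2 + 3 * sgn k * (outDir z.1).2) :=
    fun k => Iff.rfl
  simp only [hi, ho, Fin.forall_fin_two]
  rcases kagome_cases z with ⟨h1, h2, h3, h4⟩ | ⟨h1, h2, h3, h4⟩ | ⟨h1, h2, h3, h4⟩ <;>
    rw [h3, h4] <;> clear h3 h4 hi ho hz <;> generalize z.1.1 = a at * <;>
    generalize z.1.2 = b at * <;> simp only [sgn, Upper, Matrix.cons_val_zero, Matrix.cons_val_one]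
  · by_cases h : b = 0 ∧ 0 < a
    -- Between triangles the cut edges have `i ≠ j`, so the uncut edge above the path is one of
    -- scattering to the left.
    · exact Or.inr ⟨1, 1, by simp; omega, by simp; omega⟩
    · exact Or.inl ⟨0 < b, by omega, by omega⟩
  · by_cases h : b = 0 ∧ 0 < a
    · exact Or.inr ⟨1, 1, by simp; omega, by simp; omega⟩
    · exact Or.inl ⟨0 < b, by omega, by omega⟩
  · by_cases h : b = 6 ∧ a < 0
    -- Between hexagons the cut edges have `i = j`, and the uncut edge above the path is one of
    -- scattering to the right.
    · exact Or.inr ⟨1, 0, by simp; omega, by simp; omega⟩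
    · exact Or.inl ⟨0 < b, by omega, by omega⟩

lemma inVertex_turn_mem (k : Fin 2) : inVertex turn k ∈ region Upper ↔ k = 0 := by
  have h : inDir turn.1 = (0, 1) := by
    rcases kagome_cases turn with c | c | c <;> simp [turn] at c ⊢
    exact c.1
  change Upper (0 + 3 * sgn k * (inDir turn.1).1) (6 + 3 * sgn k * (inDir turn.1).2) ↔ _
  rw [h]
  fin_cases k <;> simp [sgn, Upper]

lemma outVertex_turn_mem (k : Fin 2) : outVertex turn k ∈ region Upper := by
  have h : outDir turn.1 = (1, -1) := by
    rcases kagome_cases turn with c | c | c <;> simp [turn] at c ⊢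
    exact c.2
  change Upper (0 + 3 * sgn k * (outDir turn.1).1) (6 + 3 * sgn k * (outDir turn.1).2)
  rw [h]
  fin_cases k <;> simp [sgn, Upper]

/-- The half space has a nontrivial flux for every Chalker-Coddington model whose scattering
amplitudes to the left are uniformly bounded away from `0` and `1`. -/
lemma flux_upper (S : ScatteringMatrices) (c₁ c₂ : ℝ) (hc₁ : 0 < c₁) (hc₂ : c₂ < 1)
    (hS : ∀ z : Kagome, c₁ < rAbs S z ∧ rAbs S z < c₂) :
    IndexDefined (flux S (region Upper)) ∧ index (flux S (region Upper)) = 1 := by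
  classical
  have hc₂' : 0 < c₂ := hc₁.trans ((hS turn).1.trans (hS turn).2)
  -- The bound `1 - c₁ ^ 2` controls the triangle part of the path and `c₂ ^ 2` the hexagon part;
  -- this is where both hypotheses on `|r_z|` are needed.
  obtain ⟨c, hc, h0, h1⟩ : ∃ c, (1 - c₁ ^ 2 ≤ c ∧ c₂ ^ 2 ≤ c) ∧ 0 < c ∧ c < 1 :=
    ⟨max (1 - c₁ ^ 2) (c₂ ^ 2), ⟨le_max_left _ _, le_max_right _ _⟩,
      lt_max_of_lt_right (by positivity), max_lt (by nlinarith) (by nlinarith)⟩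
  have turn_apply : ∀ ψ k, flux S (region Upper) ψ (inVertex turn k) =
      if k = 0 then 0 else ψ (inVertex turn k) := by
    intro ψ k
    rw [flux_apply_of_forall_out S _ turn outVertex_turn_mem]
    simp only [inVertex_turn_mem]
  have hsq : ∀ x, ∃ t : ℂ, (∀ ψ, (flux S (region Upper) ^ 2) ψ x = t * ψ x) ∧
      (x ≠ inVertex turn 1 → ‖t‖ ≤ c) := by
    intro x
    obtain ⟨⟨z, k⟩, rfl⟩ := inVertex_surjective x
    by_cases hz : z = turn
    · subst hz
      -- At the turn both outgoing vertices and `inVertex turn 0` lie above the path, so the block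
      -- is the projection to `inVertex turn 1`, the only place where the multiplier is `1`.
      refine ⟨if k = 0 then 0 else 1, fun ψ => ?_, fun hk => ?_⟩
      · simp only [pow_two, mul_apply_eq_comp, turn_apply]
        split_ifs <;> simp
      · have : k = 0 := by
          fin_cases k
          · rfl
          · exact absurd rfl hk
        simp [this, h0.le]
    · rcases region_upper_balanced z hz with ⟨p, ho, hi⟩ | ⟨i, j, ho, hi⟩
      · exact ⟨0, fun ψ => by
          rw [pow_two, mul_apply_eq_comp, flux_apply_of_forall S _ z p ho hi, zero_mul],
          fun _ => by simp [h0.le]⟩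
      · refine ⟨_, fun ψ => flux_sq_apply_of_one S _ z i j ho hi ψ k, fun _ => ?_⟩
        have hz := hS z
        rw [Complex.norm_real, Real.norm_eq_abs, sq_norm_eq, abs_le]
        split_ifs <;> constructor <;> nlinarith
  choose τ hτ hτ' using hsq
  have hw : flux S (region Upper) (ket (inVertex turn 1)) = ket (inVertex turn 1) := by
    have hne : ∀ z, z ≠ turn → ∀ k, inVertex z k ≠ inVertex turn 1 := fun z hz k h =>
      hz (congrArg Prod.fst (@inVertex_injective (z, k) (turn, 1) h))
    ext x
    obtain ⟨⟨z, k⟩, rfl⟩ := inVertex_surjective x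
    by_cases hz : z = turn
    · subst hz
      simp only [turn_apply]
      split_ifs with hk
      · subst hk
        have : inVertex turn 0 ≠ inVertex turn 1 := fun h => by
          simpa using congrArg Prod.snd (@inVertex_injective (turn, 0) (turn, 1) h)
        rw [ket_apply, if_neg this]
      · rfl
    · simp only [ket_apply, if_neg (hne z hz k), flux_apply]
      simp [hne z hz]
  exact ⟨indexDefined_of_sq (fun ψ x => hτ x ψ) hw hτ' h0 h1,
    index_of_sq (fun ψ x => hτ x ψ) hw hτ' h1⟩

end RubyCC

/-- Every Chalker-Coddington model on the Ruby graph with `0 < c₁ < |r_z| < c₂ < 1` for all `z`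
admits a half space projection with nontrivial index. -/
theorem mainTheorem3 (S : RubyCC.ScatteringMatrices) (c₁ c₂ : ℝ) (hc₁ : 0 < c₁) (hc₂ : c₂ < 1)
    (hS : ∀ z : RubyCC.Kagome, c₁ < RubyCC.rAbs S z ∧ RubyCC.rAbs S z < c₂) :
    ∃ (γ : ℤ → ℤ × ℤ) (M : Set RubyCC.Ruby), RubyCC.IsAdmissible γ M ∧
      RubyCC.IndexDefined (RubyCC.flux S M) ∧ RubyCC.index (RubyCC.flux S M) ≠ 0 := by
  obtain ⟨h, h'⟩ := RubyCC.flux_upper S c₁ c₂ hc₁ hc₂ hS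
  exact ⟨RubyCC.pathPoint, RubyCC.region RubyCC.Upper, RubyCC.isAdmissible_pathPoint, h,
    by rw [h']; exact one_ne_zero⟩
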